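/- For every real $p$ with $2<p<\infty$ there are constants $c_p>0$ and $c(p)>0$, depending only on $p$, such that the following holds. Let $X$ be any $n$-dimensional linear subspace of a real space $L_p(\Omega,\mathcal E,\mu)$, where $(\Omega,\mathcal E,\mu)$ is an arbitrary measure space, and let $0<\varepsilon<1$. Then there are a non-negative integer $k$ with $$k\ \ge\ c_p\,\psi(n,p,\varepsilon),\qquad \psi(n,p,\varepsilon):=\min\left\{\frac{\varepsilon^2 n}{p\,4^p},\ (\varepsilon n)^{2/p}\right\},$$ and a linear map $T:\ell_2^k\to X$ such that $\|x\|_2\le \|Tx\|_{L_p(\mu)}\le (1+\varepsilon)\|x\|_2$ for all $x\in\ell_2^k$. In particular, this $k$ satisfies $k\ge c(p)\min\{\varepsilon^2 n,\ (\varepsilon n)^{2/p}\}$. -/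

import Mathlib

/-- The function `ψ(n,p,t) = min {t² n / (p 4^p), (t n)^{2/p}}`. -/
noncomputable def embedPsi (n : ℕ) (p t : ℝ) : ℝ :=
  min (t ^ 2 * (n : ℝ) / (p * (4 : ℝ) ^ p)) ((t * (n : ℝ)) ^ (2 / p))

/-- `ℓ₂ᵏ` can be `(1+ε)`-embedded into the linear subspace `X` of `L_p(μ)`: there is a linear map
`T : ℓ₂ᵏ → X` with `‖x‖₂ ≤ ‖T x‖ ≤ (1+ε) ‖x‖₂` for all `x`. -/
def EuclideanEmbeds {Ω : Type*} [MeasurableSpace Ω] {μ : MeasureTheory.Measure Ω} {q : ENNReal}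
    (k : ℕ) (ε : ℝ) (X : Submodule ℝ (MeasureTheory.Lp ℝ q μ)) : Prop :=
  ∃ T : EuclideanSpace ℝ (Fin k) →ₗ[ℝ] X, ∀ x : EuclideanSpace ℝ (Fin k),
    ‖x‖ ≤ ‖(T x : MeasureTheory.Lp ℝ q μ)‖ ∧
      ‖(T x : MeasureTheory.Lp ℝ q μ)‖ ≤ (1 + ε) * ‖x‖

/-! This is a Dvoretzky-type argument with random Gaussian subspaces. Lewis' change of density
(`exists_isotropic_representation`) transfers the problem to ℝⁿ: there are a measure ν of mass n and
vectors |u| ≤ 1 with ∫⟨u,y⟩² dν = |y|², such that n times the p-th power of the norm becomes H(y) =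
∫|⟨u,y⟩|^p dν. Take the random map x ↦ Gx = ∑ xᵢGᵢ with independent standard Gaussian Gᵢ in ℝⁿ. It
suffices that, with positive probability, H(Gx) oscillates over the unit sphere of ℝᵏ by at most a
small multiple of ε times its value at one fixed point.

Size at the fixed point: Hölder and isotropy give H(z) ≥ c n as soon as |z|² ≥ n/2
(`le_powInt_of_isotropic`), and a Paley–Zygmund argument produces such a z outside any sufficiently
small exceptional set.

Oscillation: for unit vectors a and b, b ≠ ±a, Gb arises from Ga by rotating a pair of independent
Gaussian vectors through an angle of order |a-b|. Maurey–Pisier interpolation along the rotation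
bounds the L_q norm of H(Ga) - H(Gb) by √q |a-b| times that of |∇H|. A Bessel inequality gives |∇H|²
≤ p² ∫|⟨u,z⟩|^(2p-2) dν, and the q-th moment norm of the latter is at most of order n + q^(p-1)
(`lintegral_powInt_rpow_le`), by the same interpolation and an absorption argument. With q of order
k, chaining over the sphere (`measure_exists_increment_gt_le`) loses only a constant. The squared
oscillation is thus of order kn + k^p, which is a small multiple of (εn)² once k is below small
multiples of ε²n and (εn)^(2/p). -/

open MeasureTheory ProbabilityTheory
open scoped RealInnerProductSpace ENNReal

/-! ### Gaussian moments and orthonormal combinations of Gaussian vectors -/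

section GaussianFacts

variable {E : Type*} [NormedAddCommGroup E] [InnerProductSpace ℝ E] [FiniteDimensional ℝ E]
  [MeasurableSpace E] [BorelSpace E]

/-- The absolute moment of order `r` of a standard Gaussian variable. -/
noncomputable def gaussianAbsMoment (r : ℝ) : ℝ≥0∞ := ∫⁻ t, ‖t‖ₑ ^ r ∂(gaussianReal 0 1)

lemma gaussianAbsMoment_ne_top {r : ℝ} (hr : 0 < r) : gaussianAbsMoment r ≠ ∞ := by
  have h := IsGaussian.memLp_id (gaussianReal 0 1) (ENNReal.ofReal r) ENNReal.ofReal_ne_top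
  have h2 := lintegral_rpow_enorm_lt_top_of_eLpNorm_lt_top (by simpa using hr)
    ENNReal.ofReal_ne_top h.2
  simpa [gaussianAbsMoment, ENNReal.toReal_ofReal hr.le] using h2.ne

lemma lintegral_inner_rpow_stdGaussian (y : E) {r : ℝ} (hr : 0 ≤ r) :
    ∫⁻ z, ‖⟪y, z⟫‖ₑ ^ r ∂(stdGaussian E) = ‖y‖ₑ ^ r * gaussianAbsMoment r := by
  have h1 : (stdGaussian E).map (innerSL ℝ y) = (gaussianReal 0 1).map (fun x => ‖y‖ * x) := by
    rw [IsGaussian.map_eq_gaussianReal, gaussianReal_map_const_mul,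
      integral_strongDual_stdGaussian, variance_dual_stdGaussian, innerSL_apply_norm]
    congr 1
    · simp
    · ext; simp
  have h2 : ∫⁻ z, ‖⟪y, z⟫‖ₑ ^ r ∂(stdGaussian E)
      = ∫⁻ t, ‖t‖ₑ ^ r ∂((stdGaussian E).map (innerSL ℝ y)) := by
    rw [lintegral_map (by fun_prop) (by fun_prop)]
    rfl
  rw [h2, h1, lintegral_map (by fun_prop) (by fun_prop), gaussianAbsMoment,
    ← lintegral_const_mul _ (by fun_prop)]
  refine lintegral_congr fun t => ?_
  rw [enorm_mul, ENNReal.mul_rpow_of_nonneg _ _ hr, enorm_norm]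

/-- Raise x ≤ exp(x - 1) at x = |t|/√q to the power q. With the scale √q the Gaussian expectation of
the right side costs exp(q/2), which the factor exp(-q) absorbs. -/
lemma abs_rpow_le_exp {q : ℝ} (hq : 1 ≤ q) (t : ℝ) :
    |t| ^ q ≤ (√q) ^ q * (Real.exp (√q * t - q) + Real.exp (-√q * t - q)) := by
  have hs : 0 < √q := Real.sqrt_pos.2 (by linarith)
  have hss : √q * √q = q := Real.mul_self_sqrt (by linarith)
  have h1 : |t| / √q ≤ Real.exp (|t| / √q - 1) := by
    have := Real.add_one_le_exp (|t| / √q - 1); linarith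
  have h2 : (|t| / √q) ^ q ≤ Real.exp (√q * |t| - q) := by
    calc (|t| / √q) ^ q ≤ (Real.exp (|t| / √q - 1)) ^ q :=
          Real.rpow_le_rpow (by positivity) h1 (by linarith)
      _ = Real.exp (√q * |t| - q) := by
          rw [← Real.exp_mul]; congr 1
          have : |t| / √q * q = √q * |t| := by
            rw [div_mul_eq_mul_div, div_eq_iff hs.ne']; linear_combination -|t| * hss
          rw [sub_mul, one_mul, this]
  have h3 : Real.exp (√q * |t| - q) ≤ Real.exp (√q * t - q) + Real.exp (-√q * t - q) := by
    rcases abs_cases t with ⟨h, _⟩ | ⟨h, _⟩ <;> rw [h]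
    · linarith [Real.exp_pos (-√q * t - q)]
    · rw [mul_neg, ← neg_mul]; linarith [Real.exp_pos (√q * t - q)]
  calc |t| ^ q = (√q) ^ q * (|t| / √q) ^ q := by
        rw [← Real.mul_rpow hs.le (by positivity), mul_div_cancel₀ _ hs.ne']
    _ ≤ _ := by gcongr; exact h2.trans h3

lemma gaussianAbsMoment_le {q : ℝ} (hq : 1 ≤ q) :
    gaussianAbsMoment q ≤ ENNReal.ofReal (2 * √q) ^ q := by
  have hq0 : 0 ≤ q := by linarith
  have hi : ∀ s : ℝ, Integrable (fun t => Real.exp (s * t - q)) (gaussianReal 0 1) := fun s => by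
    simp_rw [Real.exp_sub, div_eq_mul_inv]
    exact (integrable_exp_mul_gaussianReal s).mul_const _
  have hv : ∀ s : ℝ, ∫ t, Real.exp (s * t - q) ∂(gaussianReal 0 1) = Real.exp (s ^ 2 / 2 - q) := by
    intro s
    have := mgf_gaussianReal (p := gaussianReal 0 1) (X := id) (μ := 0) (v := 1) (by simp) s
    simp only [mgf, id_eq, zero_mul, zero_add, NNReal.coe_one, one_mul] at this
    simp_rw [Real.exp_sub, integral_div, this]
  have h1 : gaussianAbsMoment q ≤ ∫⁻ t, ENNReal.ofReal
      ((√q) ^ q * (Real.exp (√q * t - q) + Real.exp (-√q * t - q))) ∂(gaussianReal 0 1) := by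
    refine lintegral_mono fun t => ?_
    rw [Real.enorm_eq_ofReal_abs, ENNReal.ofReal_rpow_of_nonneg (abs_nonneg _) hq0]
    exact ENNReal.ofReal_le_ofReal (abs_rpow_le_exp hq t)
  refine h1.trans ?_
  have hint : Integrable (fun t => (√q) ^ q *
      (Real.exp (√q * t - q) + Real.exp (-√q * t - q))) (gaussianReal 0 1) :=
    ((hi √q).add (hi (-√q))).const_mul _
  rw [← ofReal_integral_eq_lintegral_ofReal hint (ae_of_all _ fun t => by positivity),
    integral_const_mul, integral_add (hi _) (hi _), hv, hv,
    ENNReal.ofReal_rpow_of_nonneg (by positivity) hq0, Real.mul_rpow (by norm_num) (by positivity)]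
  apply ENNReal.ofReal_le_ofReal
  rw [neg_sq, Real.sq_sqrt hq0, mul_comm]
  gcongr
  have h2 : Real.exp (q / 2 - q) ≤ 1 := Real.exp_le_one_iff.2 (by linarith)
  have h3 : (2 : ℝ) ^ (1 : ℝ) ≤ 2 ^ q := Real.rpow_le_rpow_of_exponent_le (by norm_num) hq
  rw [Real.rpow_one] at h3
  linarith

lemma charFunDual_stdGaussian_innerSL (y : E) :
    charFunDual (stdGaussian E) (innerSL ℝ y) = Complex.exp (- (‖y‖ : ℂ) ^ 2 / 2) := by
  rw [charFunDual_stdGaussian, innerSL_apply_norm]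

/-- Orthonormal combinations of independent standard Gaussian vectors are independent standard
Gaussian vectors. -/
lemma map_pi_stdGaussian_orthonormal {ι : Type*} [Fintype ι] [DecidableEq ι] {a b : EuclideanSpace ℝ ι}
    (ha : ‖a‖ = 1) (hb : ‖b‖ = 1) (hab : ⟪a, b⟫ = 0) :
    (Measure.pi fun _ : ι => stdGaussian E).map (fun G => (∑ i, a i • G i, ∑ i, b i • G i))
      = (stdGaussian E).prod (stdGaussian E) := by
  let A : (ι → E) →L[ℝ] E × E :=
    (∑ i, a i • ContinuousLinearMap.proj i).prod (∑ i, b i • ContinuousLinearMap.proj i)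
  have hA : (fun G : ι → E => (∑ i, a i • G i, ∑ i, b i • G i)) = A := by
    ext G <;> simp [A]
  rw [hA]
  have : IsProbabilityMeasure ((Measure.pi fun _ : ι => stdGaussian E).map A) :=
    Measure.isProbabilityMeasure_map (by fun_prop)
  refine Measure.ext_of_charFunDual ?_
  ext L
  rw [charFunDual_map, charFunDual_pi, charFunDual_prod]
  obtain ⟨y, hy⟩ := (InnerProductSpace.toDual ℝ E).surjective (L ∘SL ContinuousLinearMap.inl ℝ E E)
  obtain ⟨w, hw⟩ := (InnerProductSpace.toDual ℝ E).surjective (L ∘SL ContinuousLinearMap.inr ℝ E E)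
  have hLi : ∀ i, (L ∘SL A) ∘SL ContinuousLinearMap.single ℝ (fun _ => E) i
      = innerSL ℝ (a i • y + b i • w) := by
    intro i
    ext v
    have h1 : L (A (Pi.single i v)) = L (a i • v, 0) + L (0, b i • v) := by
      rw [← map_add]; congr 1
      ext <;> simp [A, Pi.single_apply]
    have h2 : L (a i • v, 0) = ⟪y, a i • v⟫ := by
      exact (DFunLike.congr_fun hy (a i • v)).symm
    have h3 : L (0, b i • v) = ⟪w, b i • v⟫ := by
      exact (DFunLike.congr_fun hw (b i • v)).symm
    simp only [ContinuousLinearMap.comp_apply, ContinuousLinearMap.single_apply, innerSL_apply_apply]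
    rw [h1, h2, h3, inner_add_left, real_inner_smul_left, real_inner_smul_left,
      real_inner_smul_right, real_inner_smul_right]
  have hy' : L ∘SL ContinuousLinearMap.inl ℝ E E = innerSL ℝ y := by rw [← hy]; rfl
  have hw' : L ∘SL ContinuousLinearMap.inr ℝ E E = innerSL ℝ w := by rw [← hw]; rfl
  simp_rw [hLi, hy', hw', charFunDual_stdGaussian_innerSL]
  rw [← Complex.exp_sum, ← Complex.exp_add]
  congr 1
  have ha2 : ∑ i, a i ^ 2 = 1 := by
    have := EuclideanSpace.real_norm_sq_eq a; rw [ha] at this; simpa using this.symm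
  have hb2 : ∑ i, b i ^ 2 = 1 := by
    have := EuclideanSpace.real_norm_sq_eq b; rw [hb] at this; simpa using this.symm
  have hab2 : ∑ i, a i * b i = 0 := by
    rw [← hab, PiLp.inner_apply]; simp [mul_comm]
  -- Orthogonality of a and b kills the cross term, so the quadratic exponent of the characteristic
  -- function splits as for the product law.
  have key : ∑ i, ‖a i • y + b i • w‖ ^ 2 = ‖y‖ ^ 2 + ‖w‖ ^ 2 := by
    have : ∀ i, ‖a i • y + b i • w‖ ^ 2
        = a i ^ 2 * ‖y‖ ^ 2 + (a i * b i) * (2 * ⟪y, w⟫) + b i ^ 2 * ‖w‖ ^ 2 := by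
      intro i
      rw [norm_add_sq_real, norm_smul, norm_smul, real_inner_smul_left, real_inner_smul_right,
        mul_pow, mul_pow, Real.norm_eq_abs, Real.norm_eq_abs, sq_abs, sq_abs]
      ring
    simp_rw [this, Finset.sum_add_distrib, ← Finset.sum_mul, ha2, hb2, hab2]
    ring
  rw [← Finset.sum_div, Finset.sum_neg_distrib, ← add_div, ← neg_add]
  congr 2
  exact_mod_cast key

/-- The law of a normalized combination of independent standard Gaussian vectors. -/
lemma map_pi_stdGaussian_unit {ι : Type*} [Fintype ι] [DecidableEq ι] {a : EuclideanSpace ℝ ι}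
    (ha : ‖a‖ = 1) :
    (Measure.pi fun _ : ι => stdGaussian E).map (fun G => ∑ i, a i • G i) = stdGaussian E := by
  let A : (ι → E) →L[ℝ] E := ∑ i, a i • ContinuousLinearMap.proj i
  have hA : (fun G : ι → E => ∑ i, a i • G i) = A := by
    ext G; simp [A]
  rw [hA]
  have : IsProbabilityMeasure ((Measure.pi fun _ : ι => stdGaussian E).map A) :=
    Measure.isProbabilityMeasure_map (by fun_prop)
  refine Measure.ext_of_charFunDual ?_
  ext L
  rw [charFunDual_map, charFunDual_pi]
  obtain ⟨y, hy⟩ := (InnerProductSpace.toDual ℝ E).surjective L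
  have hLi : ∀ i, (L ∘SL A) ∘SL ContinuousLinearMap.single ℝ (fun _ => E) i
      = innerSL ℝ (a i • y) := by
    intro i
    ext v
    simp [A, Pi.single_apply, ← hy]
  have hy' : L = innerSL ℝ y := by rw [← hy]; rfl
  simp_rw [hLi, hy', charFunDual_stdGaussian_innerSL]
  rw [← Complex.exp_sum]
  congr 1
  have ha2 : ∑ i, a i ^ 2 = 1 := by
    have := EuclideanSpace.real_norm_sq_eq a; rw [ha] at this; simpa using this.symm
  have key : ∑ i, ‖a i • y‖ ^ 2 = ‖y‖ ^ 2 := by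
    simp_rw [norm_smul, mul_pow, ← Finset.sum_mul, Real.norm_eq_abs, sq_abs, ha2, one_mul]
  rw [← Finset.sum_div, Finset.sum_neg_distrib]
  congr 2
  exact_mod_cast key

end GaussianFacts

/-! ### The power functional, its gradient and their pointwise estimates -/

section Bounds

variable {S E : Type*} [NormedAddCommGroup E] [InnerProductSpace ℝ E] {u : S → E} {r : ℝ}

lemma abs_inner_le_of_norm_le_one (hu1 : ∀ ω, ‖u ω‖ ≤ 1) (ω : S) (x : E) : |⟪u ω, x⟫| ≤ ‖x‖ :=
  (abs_real_inner_le_norm _ _).trans (mul_le_of_le_one_left (norm_nonneg _) (hu1 ω))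

lemma powInt_integrand_le (hu1 : ∀ ω, ‖u ω‖ ≤ 1) (hr : 0 ≤ r) (ω : S) (x : E) :
    |⟪u ω, x⟫| ^ r ≤ ‖x‖ ^ r :=
  Real.rpow_le_rpow (abs_nonneg _) (abs_inner_le_of_norm_le_one hu1 ω x) hr

lemma powGrad_coeff_le (hu1 : ∀ ω, ‖u ω‖ ≤ 1) (hr : 2 < r) (ω : S) (x : E) :
    |r * |⟪u ω, x⟫| ^ (r - 2) * ⟪u ω, x⟫| ≤ r * ‖x‖ ^ (r - 2) * ‖x‖ := by
  rw [abs_mul, abs_mul, abs_of_pos (show 0 < r by linarith),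
    abs_of_nonneg (by positivity : 0 ≤ |⟪u ω, x⟫| ^ (r - 2))]
  have := abs_inner_le_of_norm_le_one hu1 ω x
  gcongr

lemma norm_powGrad_integrand_le (hu1 : ∀ ω, ‖u ω‖ ≤ 1) (hr : 2 < r) (ω : S) (x : E) :
    ‖(r * |⟪u ω, x⟫| ^ (r - 2) * ⟪u ω, x⟫) • u ω‖ ≤ r * ‖x‖ ^ (r - 2) * ‖x‖ := by
  rw [norm_smul, Real.norm_eq_abs]
  exact (mul_le_of_le_one_right (abs_nonneg _) (hu1 ω)).trans (powGrad_coeff_le hu1 hr ω x)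

end Bounds

section Functional

variable {S : Type*} [MeasurableSpace S] {E : Type*} [NormedAddCommGroup E]
  [InnerProductSpace ℝ E]

/-- The functional `x ↦ ∫ |⟨u, x⟩|^r dν`. -/
noncomputable def powInt (ν : Measure S) (u : S → E) (r : ℝ) (x : E) : ℝ :=
  ∫ ω, |⟪u ω, x⟫| ^ r ∂ν

/-- The gradient of `powInt`. -/
noncomputable def powGrad (ν : Measure S) (u : S → E) (r : ℝ) (x : E) : E :=
  ∫ ω, (r * |⟪u ω, x⟫| ^ (r - 2) * ⟪u ω, x⟫) • u ω ∂ν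

variable {ν : Measure S} {u : S → E} {r : ℝ}

lemma powInt_nonneg (x : E) : 0 ≤ powInt ν u r x :=
  integral_nonneg fun _ => by positivity

variable [FiniteDimensional ℝ E] [MeasurableSpace E] [BorelSpace E] [IsFiniteMeasure ν]

lemma integrable_powInt (hu : Measurable u) (hu1 : ∀ ω, ‖u ω‖ ≤ 1) (hr : 0 ≤ r) (x : E) :
    Integrable (fun ω => |⟪u ω, x⟫| ^ r) ν := by
  refine Integrable.of_bound (C := ‖x‖ ^ r) (by fun_prop) (ae_of_all _ fun ω => ?_)
  rw [Real.norm_of_nonneg (by positivity)]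
  exact powInt_integrand_le hu1 hr ω x

lemma integrable_powGrad (hu : Measurable u) (hu1 : ∀ ω, ‖u ω‖ ≤ 1) (hr : 2 < r) (x : E) :
    Integrable (fun ω => (r * |⟪u ω, x⟫| ^ (r - 2) * ⟪u ω, x⟫) • u ω) ν :=
  Integrable.of_bound (C := r * ‖x‖ ^ (r - 2) * ‖x‖) (by fun_prop)
    (ae_of_all _ fun ω => norm_powGrad_integrand_le hu1 hr ω x)

lemma continuous_powInt (hu : Measurable u) (hu1 : ∀ ω, ‖u ω‖ ≤ 1) (hr : 0 < r) :
    Continuous (powInt ν u r) := by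
  rw [continuous_iff_continuousAt]
  intro x₀
  refine continuousAt_of_dominated (bound := fun _ => (‖x₀‖ + 1) ^ r)
    (Filter.Eventually.of_forall fun x => (integrable_powInt hu hu1 hr.le x).1) ?_ (integrable_const _)
    (ae_of_all _ fun ω => ?_)
  · filter_upwards [Metric.ball_mem_nhds x₀ one_pos] with x hx
    refine ae_of_all _ fun ω => ?_
    rw [Real.norm_of_nonneg (by positivity)]
    refine (powInt_integrand_le hu1 hr.le ω x).trans ?_
    gcongr
    rw [mem_ball_iff_norm] at hx
    linarith [norm_le_norm_add_norm_sub' x x₀]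
  · exact (Continuous.rpow_const (by fun_prop) fun _ => Or.inr hr.le).continuousAt

lemma continuous_powGrad (hu : Measurable u) (hu1 : ∀ ω, ‖u ω‖ ≤ 1) (hr : 2 < r) :
    Continuous (powGrad ν u r) := by
  rw [continuous_iff_continuousAt]
  intro x₀
  refine continuousAt_of_dominated (bound := fun _ => r * (‖x₀‖ + 1) ^ (r - 2) * (‖x₀‖ + 1))
    (Filter.Eventually.of_forall fun x => by fun_prop) ?_ (integrable_const _)
    (ae_of_all _ fun ω => ?_)
  · filter_upwards [Metric.ball_mem_nhds x₀ one_pos] with x hx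
    refine ae_of_all _ fun ω => (norm_powGrad_integrand_le hu1 hr ω x).trans ?_
    rw [mem_ball_iff_norm] at hx
    have : ‖x‖ ≤ ‖x₀‖ + 1 := by linarith [norm_le_norm_add_norm_sub' x x₀]
    gcongr
  · have : Continuous fun x => |⟪u ω, x⟫| ^ (r - 2) :=
      Continuous.rpow_const (by fun_prop) fun _ => Or.inr (by linarith)
    exact Continuous.continuousAt (by fun_prop)

lemma inner_powGrad (hu : Measurable u) (hu1 : ∀ ω, ‖u ω‖ ≤ 1) (hr : 2 < r) (x y : E) :
    ⟪powGrad ν u r x, y⟫ = ∫ ω, r * |⟪u ω, x⟫| ^ (r - 2) * ⟪u ω, x⟫ * ⟪u ω, y⟫ ∂ν := by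
  rw [powGrad, real_inner_comm, ← integral_inner (integrable_powGrad hu hu1 hr x)]
  refine integral_congr_ae (ae_of_all _ fun ω => ?_)
  simp only [real_inner_smul_right, real_inner_comm]

lemma hasFDerivAt_powInt (hu : Measurable u) (hu1 : ∀ ω, ‖u ω‖ ≤ 1) (hr : 2 < r) (x : E) :
    HasFDerivAt (powInt ν u r) (innerSL ℝ (powGrad ν u r x)) x := by
  have h := hasFDerivAt_integral_of_dominated_of_fderiv_le (μ := ν) (x₀ := x)
    (F := fun x ω => |⟪u ω, x⟫| ^ r)
    (F' := fun x ω => (r * |⟪u ω, x⟫| ^ (r - 2) * ⟪u ω, x⟫) • innerSL ℝ (u ω))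
    (bound := fun _ => r * (‖x‖ + 1) ^ (r - 2) * (‖x‖ + 1))
    (Metric.ball_mem_nhds x one_pos)
    (Filter.Eventually.of_forall fun x => (integrable_powInt hu hu1 (by linarith) x).1)
    (integrable_powInt hu hu1 (by linarith) x) (by
      have : Measurable fun ω => innerSL ℝ (u ω) := (innerSL ℝ).continuous.measurable.comp hu
      fun_prop) (ae_of_all _ fun ω y hy => ?_)
    (integrable_const _) (ae_of_all _ fun ω y _ => ?_)
  · have : (∫ ω, (r * |⟪u ω, x⟫| ^ (r - 2) * ⟪u ω, x⟫) • innerSL ℝ (u ω) ∂ν)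
        = innerSL ℝ (powGrad ν u r x) := by
      rw [powGrad, ← ContinuousLinearMap.integral_comp_comm _ (integrable_powGrad hu hu1 hr x)]
      simp
    rw [← this]
    exact h
  · rw [norm_smul, innerSL_apply_norm, ← norm_smul]
    refine (norm_powGrad_integrand_le hu1 hr ω y).trans ?_
    rw [mem_ball_iff_norm] at hy
    have : ‖y‖ ≤ ‖x‖ + 1 := by linarith [norm_le_norm_add_norm_sub' y x]
    gcongr
  · have h1 := hasDerivAt_abs_rpow (⟪u ω, y⟫) (p := r) (by linarith)
    exact h1.comp_hasFDerivAt y (innerSL ℝ (u ω)).hasFDerivAt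

/-- The Bessel inequality for the gradient of `powInt`. -/
lemma norm_powGrad_sq_le (hu : Measurable u) (hu1 : ∀ ω, ‖u ω‖ ≤ 1)
    (hiso : ∀ y, ∫ ω, ⟪u ω, y⟫ ^ 2 ∂ν ≤ ‖y‖ ^ 2) (hr : 2 < r) (x : E) :
    ‖powGrad ν u r x‖ ^ 2 ≤ r ^ 2 * powInt ν u (2 * r - 2) x := by
  set D := powGrad ν u r x with hD
  have h2 : Integrable (fun ω => ⟪u ω, D⟫ ^ 2) ν := by
    have := integrable_powInt (ν := ν) hu hu1 (r := 2) (by norm_num) D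
    simpa using this
  have h3 := integrable_powInt (ν := ν) hu hu1 (r := 2 * r - 2) (by linarith) x
  -- Pair the gradient with itself and apply 2αβ ≤ α² + β² under the integral. By `hiso` the second
  -- term is at most ‖D‖²/2 and is absorbed on the left.
  have h1 : ‖D‖ ^ 2 ≤ ∫ ω, (r ^ 2 / 2 * |⟪u ω, x⟫| ^ (2 * r - 2) + 1 / 2 * ⟪u ω, D⟫ ^ 2) ∂ν := by
    rw [← real_inner_self_eq_norm_sq, show ⟪D, D⟫ = ⟪powGrad ν u r x, D⟫ from rfl,
      inner_powGrad hu hu1 hr]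
    refine integral_mono ?_ ((h3.const_mul _).add (h2.const_mul _)) fun ω => ?_
    · refine Integrable.of_bound (C := (r * ‖x‖ ^ (r - 2) * ‖x‖) * ‖D‖) (by fun_prop)
        (ae_of_all _ fun ω => ?_)
      rw [norm_mul]
      exact mul_le_mul (powGrad_coeff_le hu1 hr ω x) (abs_inner_le_of_norm_le_one hu1 ω D)
        (norm_nonneg _) (by have := norm_nonneg x; positivity)
    · have h4 : |⟪u ω, x⟫| ^ (2 * r - 2) = (|⟪u ω, x⟫| ^ (r - 2) * ⟪u ω, x⟫) ^ 2 := by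
        rw [mul_pow, ← sq_abs (⟪u ω, x⟫), ← Real.rpow_natCast, ← Real.rpow_mul (abs_nonneg _),
          ← Real.rpow_natCast |⟪u ω, x⟫| 2, ← Real.rpow_add_of_nonneg (abs_nonneg _)]
        · congr 1; push_cast; ring
        · push_cast; nlinarith
        · norm_num
      simp only
      rw [h4]
      nlinarith [sq_nonneg (r * (|⟪u ω, x⟫| ^ (r - 2) * ⟪u ω, x⟫) - ⟪u ω, D⟫)]
  rw [integral_add (h3.const_mul _) (h2.const_mul _), integral_const_mul, integral_const_mul] at h1
  have := hiso D
  unfold powInt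
  linarith

lemma powInt_le_norm_rpow (hu : Measurable u) (hu1 : ∀ ω, ‖u ω‖ ≤ 1)
    (hiso : ∀ y, ∫ ω, ⟪u ω, y⟫ ^ 2 ∂ν ≤ ‖y‖ ^ 2) (hr : 2 < r) (x : E) :
    powInt ν u r x ≤ ‖x‖ ^ r := by
  have h2 : Integrable (fun ω => ⟪u ω, x⟫ ^ 2) ν := by
    have := integrable_powInt (ν := ν) hu hu1 (r := 2) (by norm_num) x
    simpa using this
  have hsplit : ∀ t : ℝ, 0 ≤ t → t ^ r = t ^ (r - 2) * t ^ 2 := fun t ht => by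
    rw [← Real.rpow_natCast t 2, ← Real.rpow_add_of_nonneg ht (by linarith) (by norm_num)]
    congr 1; push_cast; ring
  calc powInt ν u r x ≤ ∫ ω, ‖x‖ ^ (r - 2) * ⟪u ω, x⟫ ^ 2 ∂ν := by
        refine integral_mono (integrable_powInt hu hu1 (by linarith) x) (h2.const_mul _)
          fun ω => ?_
        simp only
        rw [hsplit _ (abs_nonneg _), sq_abs]
        gcongr
        exact abs_inner_le_of_norm_le_one hu1 ω x
    _ ≤ ‖x‖ ^ (r - 2) * ‖x‖ ^ 2 := by
        rw [integral_const_mul]; gcongr; exact hiso x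
    _ = ‖x‖ ^ r := (hsplit _ (norm_nonneg _)).symm

/-- Young's inequality with explicit constants: the left side is s^(r-1)·(8rKb)/8, and whichever of
s and 8rKb is larger dominates. -/
lemma mul_rpow_sub_one_le {r K s b : ℝ} (hr : 2 < r) (hK : 0 ≤ K) (hs : 0 ≤ s) (hb : 0 ≤ b) :
    K * (r * s ^ (r - 2) * s * b) ≤ s ^ r / 8 + (8 * r * K) ^ r * b ^ r := by
  have hsplit : ∀ t : ℝ, 0 ≤ t → t ^ r = t ^ (r - 2) * t * t := fun t ht => by
    rw [mul_assoc, ← sq, ← Real.rpow_natCast t 2,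
      ← Real.rpow_add_of_nonneg ht (by linarith) (by norm_num)]
    congr 1; push_cast; ring
  have hc : 0 ≤ 8 * r * K * b := by positivity
  rw [← Real.mul_rpow (by positivity) hb, hsplit s hs, hsplit _ hc]
  rcases le_total (8 * r * K * b) s with h | h
  · have : 0 ≤ (8 * r * K * b) ^ (r - 2) * (8 * r * K * b) * (8 * r * K * b) := by positivity
    have h2 : s ^ (r - 2) * s * (8 * r * K * b) ≤ s ^ (r - 2) * s * s := by gcongr
    nlinarith
  · have h2 : s ^ (r - 2) * s * (8 * r * K * b)
        ≤ (8 * r * K * b) ^ (r - 2) * (8 * r * K * b) * (8 * r * K * b) := by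
      gcongr
    have : 0 ≤ s ^ (r - 2) * s * s := by positivity
    have h3 : 0 ≤ s ^ (r - 2) * s * (8 * r * K * b) := by positivity
    nlinarith

/-- The gradient of `powInt` is controlled by `powInt` itself. -/
lemma mul_norm_powGrad_le (hu : Measurable u) (hu1 : ∀ ω, ‖u ω‖ ≤ 1)
    (hiso : ∀ y, ∫ ω, ⟪u ω, y⟫ ^ 2 ∂ν ≤ ‖y‖ ^ 2) (hr : 2 < r) {K : ℝ} (hK : 0 ≤ K) (x : E) :
    K * ‖powGrad ν u r x‖ ≤ powInt ν u r x / 8 + (8 * r * K) ^ r := by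
  have hr0 : 0 ≤ 8 * r * K := by nlinarith
  rcases eq_or_ne (powGrad ν u r x) 0 with h0 | h0
  · rw [h0, norm_zero, mul_zero]
    have := powInt_nonneg (ν := ν) (u := u) (r := r) x
    positivity
  set D := powGrad ν u r x with hD
  -- Test the gradient against its own direction. The functional is at most 1 at the unit vector y,
  -- so Young's inequality under the integral costs only the constant (8rK)^r.
  set y := ‖D‖⁻¹ • D with hy
  have hDn : ‖D‖ ≠ 0 := norm_ne_zero_iff.2 h0
  have hy1 : ‖y‖ = 1 := by rw [hy, norm_smul, norm_inv, norm_norm, inv_mul_cancel₀ hDn]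
  have hDy : ‖D‖ = ⟪D, y⟫ := by
    rw [hy, real_inner_smul_right, real_inner_self_eq_norm_sq]; field_simp
  have hIx := integrable_powInt (ν := ν) hu hu1 (r := r) (by linarith) x
  have hIy := integrable_powInt (ν := ν) hu hu1 (r := r) (by linarith) y
  have hint : Integrable (fun ω => r * |⟪u ω, x⟫| ^ (r - 2) * ⟪u ω, x⟫ * ⟪u ω, y⟫) ν := by
    refine Integrable.of_bound (C := (r * ‖x‖ ^ (r - 2) * ‖x‖) * ‖y‖) (by fun_prop)
      (ae_of_all _ fun ω => ?_)
    rw [norm_mul]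
    exact mul_le_mul (powGrad_coeff_le hu1 hr ω x) (abs_inner_le_of_norm_le_one hu1 ω y)
      (norm_nonneg _) (by have := norm_nonneg x; positivity)
  have h1 : K * ‖D‖ ≤ ∫ ω, (|⟪u ω, x⟫| ^ r / 8 + (8 * r * K) ^ r * |⟪u ω, y⟫| ^ r) ∂ν := by
    rw [hDy, hD, inner_powGrad hu hu1 hr, ← integral_const_mul]
    refine integral_mono (hint.const_mul _) ((hIx.div_const _).add (hIy.const_mul _)) fun ω => ?_
    refine le_trans ?_ (mul_rpow_sub_one_le hr hK (abs_nonneg _) (abs_nonneg _))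
    have hle : ⟪u ω, x⟫ * ⟪u ω, y⟫ ≤ |⟪u ω, x⟫| * |⟪u ω, y⟫| := by
      rw [← abs_mul]; exact le_abs_self _
    simp only [mul_assoc]
    have : 0 ≤ r := by linarith
    gcongr
  rw [integral_add (hIx.div_const _) (hIy.const_mul _), integral_div, integral_const_mul] at h1
  have h2 := powInt_le_norm_rpow hu hu1 hiso hr y
  rw [hy1, Real.one_rpow] at h2
  refine h1.trans ?_
  unfold powInt at h2 ⊢
  gcongr
  exact mul_le_of_le_one_right (by positivity) h2

lemma enorm_powGrad_rpow_le (hu : Measurable u) (hu1 : ∀ ω, ‖u ω‖ ≤ 1)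
    (hiso : ∀ y, ∫ ω, ⟪u ω, y⟫ ^ 2 ∂ν ≤ ‖y‖ ^ 2) (hr : 2 < r) {q : ℝ} (hq : 0 ≤ q) (x : E) :
    ‖powGrad ν u r x‖ₑ ^ (2 * q)
      ≤ ENNReal.ofReal (r ^ 2) ^ q * ENNReal.ofReal (powInt ν u (2 * r - 2) x) ^ q := by
  rw [ENNReal.rpow_mul, ← ENNReal.mul_rpow_of_nonneg _ _ hq, ← ENNReal.ofReal_mul (by positivity)]
  gcongr
  rw [← ofReal_norm, ENNReal.ofReal_rpow_of_nonneg (norm_nonneg _) (by norm_num)]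
  apply ENNReal.ofReal_le_ofReal
  simpa using norm_powGrad_sq_le hu hu1 hiso hr x

end Functional

lemma rpow_lintegral_le {α : Type*} [MeasurableSpace α] (μ : Measure α) {q : ℝ} (hq : 1 ≤ q)
    {g : α → ℝ≥0∞} (hg : Measurable g) :
    (∫⁻ t, g t ∂μ) ^ q ≤ μ Set.univ ^ (q - 1) * ∫⁻ t, g t ^ q ∂μ := by
  have hq0 : 0 < q := by linarith
  rcases eq_or_lt_of_le hq with rfl | hq1
  · simp
  have hc : q.HolderConjugate (q.conjExponent) := .conjExponent hq1
  have h := ENNReal.lintegral_mul_le_Lp_mul_Lq μ hc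
    hg.aemeasurable (aemeasurable_const (b := (1 : ℝ≥0∞)))
  simp only [Pi.mul_apply, mul_one, ENNReal.one_rpow, lintegral_const, one_mul] at h
  calc (∫⁻ t, g t ∂μ) ^ q
      ≤ ((∫⁻ t, g t ^ q ∂μ) ^ (1 / q) * μ Set.univ ^ (1 / q.conjExponent)) ^ q := by
        gcongr
    _ = _ := by
        rw [ENNReal.mul_rpow_of_nonneg _ _ hq0.le, ← ENNReal.rpow_mul, ← ENNReal.rpow_mul,
          one_div_mul_cancel hq0.ne', ENNReal.rpow_one, mul_comm]
        congr 2
        rw [Real.conjExponent]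
        field_simp

lemma lintegral_const_mul_lintegral_swap {α β : Type*} [MeasurableSpace α] [MeasurableSpace β]
    (μ : Measure α) (ρ : Measure β) [SFinite μ] [SFinite ρ] {g : β → α → ℝ≥0∞}
    (hg : Measurable fun x : β × α => g x.1 x.2) (c : ℝ≥0∞) :
    ∫⁻ a, (c * ∫⁻ b, g b a ∂ρ) ∂μ = c * ∫⁻ b, ∫⁻ a, g b a ∂μ ∂ρ := by
  have hsw : Measurable fun x : α × β => g x.2 x.1 := hg.comp measurable_swap
  rw [lintegral_const_mul _ hsw.lintegral_prod_right', lintegral_lintegral_swap]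
  exact hsw.aemeasurable

/-! ### Maurey–Pisier interpolation along Gaussian rotations -/

section Increments

variable {S : Type*} [MeasurableSpace S] {E : Type*} [NormedAddCommGroup E]
  [InnerProductSpace ℝ E] [FiniteDimensional ℝ E] [MeasurableSpace E] [BorelSpace E]
  {ν : Measure S} {u : S → E} {r : ℝ} [IsFiniteMeasure ν]

lemma hasDerivAt_powInt_rotation (hu : Measurable u) (hu1 : ∀ ω, ‖u ω‖ ≤ 1) (hr : 2 < r)
    (z : E × E) (t : ℝ) :
    HasDerivAt (fun t => powInt ν u r (ContinuousLinearMap.rotation t z).1)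
      ⟪powGrad ν u r (ContinuousLinearMap.rotation t z).1,
        (ContinuousLinearMap.rotation t z).2⟫ t := by
  simp only [ContinuousLinearMap.rotation_apply]
  have h1 : HasDerivAt (fun t => Real.cos t • z.1 + Real.sin t • z.2)
      (-Real.sin t • z.1 + Real.cos t • z.2) t :=
    ((Real.hasDerivAt_cos t).smul_const z.1).add ((Real.hasDerivAt_sin t).smul_const z.2)
  exact (hasFDerivAt_powInt hu hu1 hr _).comp_hasDerivAt t h1

/-- Increments of `powInt` along a rotation of two independent Gaussian vectors. -/
lemma lintegral_powInt_rotation_sub_le (hu : Measurable u) (hu1 : ∀ ω, ‖u ω‖ ≤ 1) (hr : 2 < r)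
    {τ : ℝ} (hτ : 0 ≤ τ) {q : ℝ} (hq : 1 ≤ q) :
    ∫⁻ z, ‖powInt ν u r (Real.cos τ • z.1 + Real.sin τ • z.2) - powInt ν u r z.1‖ₑ ^ q
        ∂((stdGaussian E).prod (stdGaussian E))
      ≤ ENNReal.ofReal (2 * √q * τ) ^ q * ∫⁻ z, ‖powGrad ν u r z‖ₑ ^ q ∂(stdGaussian E) := by
  have hq0 : 0 < q := by linarith
  have hD := continuous_powGrad (ν := ν) hu hu1 hr
  let ψ : E × E → ℝ≥0∞ := fun z => ‖⟪powGrad ν u r z.1, z.2⟫‖ₑ ^ q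
  have hψ : Measurable ψ := by
    have : Continuous fun z : E × E => ⟪powGrad ν u r z.1, z.2⟫ := by fun_prop
    exact this.measurable.enorm.pow_const _
  have hrotc : Continuous fun tz : ℝ × (E × E) => ContinuousLinearMap.rotation tz.1 tz.2 := by
    simp only [ContinuousLinearMap.rotation_apply]
    fun_prop
  -- The increment is the integral over the angle of its derivative; Jensen on [0, τ] takes the
  -- power q inside.
  have hpt : ∀ z : E × E,
      ‖powInt ν u r (Real.cos τ • z.1 + Real.sin τ • z.2) - powInt ν u r z.1‖ₑ ^ q
        ≤ ENNReal.ofReal τ ^ (q - 1) *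
          ∫⁻ t in Set.Ioc 0 τ, ψ (ContinuousLinearMap.rotation t z) := by
    intro z
    have hcont : Continuous fun t : ℝ => ⟪powGrad ν u r (ContinuousLinearMap.rotation t z).1,
        (ContinuousLinearMap.rotation t z).2⟫ := by
      simp only [ContinuousLinearMap.rotation_apply]
      fun_prop
    have hftc := intervalIntegral.integral_eq_sub_of_hasDerivAt (a := 0) (b := τ)
      (fun t _ => hasDerivAt_powInt_rotation (ν := ν) hu hu1 hr z t)
      (hcont.intervalIntegrable _ _)
    simp only [ContinuousLinearMap.rotation_apply (0 : ℝ), ContinuousLinearMap.rotation_apply τ,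
      Real.cos_zero, Real.sin_zero, one_smul, zero_smul, add_zero] at hftc
    rw [← hftc, intervalIntegral.integral_of_le hτ]
    have hJ := rpow_lintegral_le (volume.restrict (Set.Ioc 0 τ)) hq hcont.measurable.enorm
    rw [Measure.restrict_apply MeasurableSet.univ, Set.univ_inter, Real.volume_Ioc, sub_zero] at hJ
    refine le_trans ?_ hJ
    gcongr
    exact enorm_integral_le_lintegral_enorm _
  -- The Gaussian pair is rotation invariant, so at every angle the derivative is distributed as
  -- ⟨∇H(z₁), z₂⟩ with z₂ independent of z₁. Integrating over z₂ first leaves a one-dimensional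
  -- Gaussian moment.
  have hrot : ∀ t : ℝ, ∫⁻ z, ψ (ContinuousLinearMap.rotation t z)
      ∂((stdGaussian E).prod (stdGaussian E)) = gaussianAbsMoment q *
        ∫⁻ z, ‖powGrad ν u r z‖ₑ ^ q ∂(stdGaussian E) := by
    intro t
    rw [← lintegral_map hψ (by fun_prop),
      IsGaussian.map_rotation_eq_self (by simp) t, lintegral_prod _ hψ.aemeasurable]
    simp only [ψ]
    simp_rw [lintegral_inner_rpow_stdGaussian _ hq0.le]
    rw [lintegral_mul_const _ (hD.measurable.enorm.pow_const _), mul_comm]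
  have hmeas : Measurable fun tz : ℝ × (E × E) => ψ (ContinuousLinearMap.rotation tz.1 tz.2) :=
    hψ.comp hrotc.measurable
  calc _ ≤ ∫⁻ z, (ENNReal.ofReal τ ^ (q - 1) *
          ∫⁻ t in Set.Ioc 0 τ, ψ (ContinuousLinearMap.rotation t z))
          ∂((stdGaussian E).prod (stdGaussian E)) := lintegral_mono hpt
    _ = ENNReal.ofReal τ ^ (q - 1) * ∫⁻ t in Set.Ioc 0 τ, ∫⁻ z,
          ψ (ContinuousLinearMap.rotation t z) ∂((stdGaussian E).prod (stdGaussian E)) := by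
        exact lintegral_const_mul_lintegral_swap _ _
          (g := fun t z => ψ (ContinuousLinearMap.rotation t z)) hmeas _
    _ = (gaussianAbsMoment q * ENNReal.ofReal τ ^ q) *
          ∫⁻ z, ‖powGrad ν u r z‖ₑ ^ q ∂(stdGaussian E) := by
        simp_rw [hrot]
        rw [lintegral_const, Measure.restrict_apply MeasurableSet.univ, Set.univ_inter,
          Real.volume_Ioc, sub_zero]
        have : ENNReal.ofReal τ ^ q = ENNReal.ofReal τ ^ (q - 1) * ENNReal.ofReal τ := by
          conv_rhs => rw [← ENNReal.rpow_one (ENNReal.ofReal τ), ← ENNReal.rpow_mul, one_mul]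
          rw [← ENNReal.rpow_add_of_nonneg _ _ (by linarith) zero_le_one, sub_add_cancel]
        rw [this]; ring
    _ ≤ _ := by
        rw [ENNReal.ofReal_mul (by positivity), ENNReal.mul_rpow_of_nonneg _ _ hq0.le]
        gcongr
        exact gaussianAbsMoment_le hq

lemma lintegral_powInt_stdGaussian_le (hu : Measurable u) (hu1 : ∀ ω, ‖u ω‖ ≤ 1) (hr : 0 < r) :
    ∫⁻ z, ENNReal.ofReal (powInt ν u r z) ∂(stdGaussian E)
      ≤ ν Set.univ * gaussianAbsMoment r := by
  have h1 : ∀ z, ENNReal.ofReal (powInt ν u r z) = ∫⁻ ω, ‖⟪u ω, z⟫‖ₑ ^ r ∂ν := by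
    intro z
    rw [powInt, ofReal_integral_eq_lintegral_ofReal (integrable_powInt hu hu1 hr.le z)
      (ae_of_all _ fun _ => by positivity)]
    refine lintegral_congr fun ω => ?_
    rw [Real.enorm_eq_ofReal_abs, ENNReal.ofReal_rpow_of_nonneg (abs_nonneg _) hr.le]
  simp_rw [h1]
  rw [lintegral_lintegral_swap]
  · simp_rw [lintegral_inner_rpow_stdGaussian _ hr.le]
    calc _ ≤ ∫⁻ _, gaussianAbsMoment r ∂ν := by
          refine lintegral_mono fun ω => ?_
          refine mul_le_of_le_one_left' (ENNReal.rpow_le_one ?_ hr.le)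
          rw [← ofReal_norm]
          exact ENNReal.ofReal_le_one.2 (hu1 ω)
      _ = _ := by rw [lintegral_const, mul_comm]
  · have : Measurable fun p : E × S => ⟪u p.2, p.1⟫ := by fun_prop
    exact (this.enorm.pow_const r).aemeasurable

end Increments

/-! ### Moments of the power functional by self-bounding -/

section Moments

variable {S : Type*} [MeasurableSpace S] {E : Type*} [NormedAddCommGroup E]
  [InnerProductSpace ℝ E] [FiniteDimensional ℝ E] [MeasurableSpace E] [BorelSpace E]
  {ν : Measure S} {u : S → E} {r : ℝ} [IsFiniteMeasure ν]

lemma ENNReal.add_rpow_le_two_rpow_mul (x y : ℝ≥0∞) {q : ℝ} (hq : 1 ≤ q) :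
    (x + y) ^ q ≤ 2 ^ q * (x ^ q + y ^ q) :=
  (ENNReal.rpow_add_le_mul_rpow_add_rpow x y hq).trans <| by
    gcongr
    · norm_num
    · linarith

lemma lintegral_powInt_rpow_ne_top (hu : Measurable u) (hu1 : ∀ ω, ‖u ω‖ ≤ 1)
    (hiso : ∀ y, ∫ ω, ⟪u ω, y⟫ ^ 2 ∂ν ≤ ‖y‖ ^ 2) (hr : 2 < r) {q : ℝ} (hq : 1 ≤ q) :
    ∫⁻ z, ENNReal.ofReal (powInt ν u r z) ^ q ∂(stdGaussian E) ≠ ∞ := by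
  have hrq : 0 < r * q := by nlinarith
  have h := IsGaussian.memLp_id (stdGaussian E) (ENNReal.ofReal (r * q)) ENNReal.ofReal_ne_top
  have h2 := lintegral_rpow_enorm_lt_top_of_eLpNorm_lt_top (by simpa using hrq)
    ENNReal.ofReal_ne_top h.2
  rw [ENNReal.toReal_ofReal hrq.le] at h2
  refine ne_top_of_le_ne_top h2.ne (lintegral_mono fun z => ?_)
  simp only [id_eq]
  rw [ENNReal.rpow_mul]
  gcongr
  rw [← ofReal_norm, ENNReal.ofReal_rpow_of_nonneg (norm_nonneg _) (by linarith)]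
  exact ENNReal.ofReal_le_ofReal (powInt_le_norm_rpow hu hu1 hiso hr z)

lemma integrable_powInt_stdGaussian (hu : Measurable u) (hu1 : ∀ ω, ‖u ω‖ ≤ 1)
    (hiso : ∀ y, ∫ ω, ⟪u ω, y⟫ ^ 2 ∂ν ≤ ‖y‖ ^ 2) (hr : 2 < r) :
    Integrable (powInt ν u r) (stdGaussian E) := by
  refine ⟨(continuous_powInt hu hu1 (by linarith)).aestronglyMeasurable, ?_⟩
  rw [hasFiniteIntegral_iff_ofReal (ae_of_all _ powInt_nonneg)]
  simpa [lt_top_iff_ne_top] using lintegral_powInt_rpow_ne_top hu hu1 hiso hr le_rfl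

/-- By Jensen the mean may be replaced by an independent copy, which is the rotation by π/2. The
interpolation factor is then π√q, and `mul_norm_powGrad_le` with K = π√q bounds the gradient term by
an eighth of the functional itself plus a constant. -/
lemma lintegral_powInt_sub_integral_le (hu : Measurable u) (hu1 : ∀ ω, ‖u ω‖ ≤ 1)
    (hiso : ∀ y, ∫ ω, ⟪u ω, y⟫ ^ 2 ∂ν ≤ ‖y‖ ^ 2) (hr : 2 < r) {q : ℝ} (hq : 1 ≤ q) :
    ∫⁻ z, ‖powInt ν u r z - ∫ z', powInt ν u r z' ∂(stdGaussian E)‖ₑ ^ q ∂(stdGaussian E)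
      ≤ 2 ^ q * (8⁻¹ ^ q * ∫⁻ z, ENNReal.ofReal (powInt ν u r z) ^ q ∂(stdGaussian E)
        + ENNReal.ofReal ((8 * r * (Real.pi * √q)) ^ r) ^ q) := by
  have hq0 : 0 < q := by linarith
  have hpi := Real.pi_pos
  have hH : Continuous (powInt ν u r) := continuous_powInt hu hu1 (by linarith)
  have hI := integrable_powInt_stdGaussian hu hu1 hiso hr
  have h1 : ∀ z, ‖powInt ν u r z - ∫ z', powInt ν u r z' ∂(stdGaussian E)‖ₑ ^ q
      ≤ ∫⁻ z', ‖powInt ν u r z' - powInt ν u r z‖ₑ ^ q ∂(stdGaussian E) := by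
    intro z
    have h2 : powInt ν u r z - ∫ z', powInt ν u r z' ∂(stdGaussian E)
        = ∫ z', (powInt ν u r z - powInt ν u r z') ∂(stdGaussian E) := by
      rw [integral_sub (integrable_const _) hI]; simp
    have h3 := rpow_lintegral_le (stdGaussian E) hq
      (g := fun z' => ‖powInt ν u r z - powInt ν u r z'‖ₑ) (by fun_prop)
    rw [measure_univ, ENNReal.one_rpow, one_mul] at h3
    simp_rw [enorm_sub_rev _ (powInt ν u r z)]
    rw [h2]
    refine le_trans ?_ h3
    gcongr
    exact enorm_integral_le_lintegral_enorm _
  have hrot := lintegral_powInt_rotation_sub_le (ν := ν) hu hu1 hr (τ := Real.pi / 2)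
    (by positivity) hq
  simp only [Real.cos_pi_div_two, Real.sin_pi_div_two, zero_smul, one_smul, zero_add] at hrot
  rw [lintegral_prod _ (by fun_prop)] at hrot
  refine (lintegral_mono h1).trans (hrot.trans ?_)
  rw [← lintegral_const_mul _ ((continuous_powGrad hu hu1 hr).measurable.enorm.pow_const _)]
  have h4 : ∀ z, ENNReal.ofReal (2 * √q * (Real.pi / 2)) ^ q * ‖powGrad ν u r z‖ₑ ^ q
      ≤ 2 ^ q * (8⁻¹ ^ q * ENNReal.ofReal (powInt ν u r z) ^ q
        + ENNReal.ofReal ((8 * r * (Real.pi * √q)) ^ r) ^ q) := by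
    intro z
    have h8 : (8⁻¹ : ℝ≥0∞) = ENNReal.ofReal (8⁻¹) := by
      rw [ENNReal.ofReal_inv_of_pos (by norm_num)]; norm_num
    rw [← ENNReal.mul_rpow_of_nonneg _ _ hq0.le, ← ENNReal.mul_rpow_of_nonneg _ _ hq0.le, h8,
      ← ENNReal.ofReal_mul (by norm_num), ← ofReal_norm, ← ENNReal.ofReal_mul (by positivity)]
    refine le_trans ?_ (ENNReal.add_rpow_le_two_rpow_mul _ _ hq)
    gcongr
    rw [← ENNReal.ofReal_add (mul_nonneg (by norm_num) (powInt_nonneg z))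
      (Real.rpow_nonneg (by nlinarith [mul_nonneg hpi.le (Real.sqrt_nonneg q)]) _)]
    apply ENNReal.ofReal_le_ofReal
    have := mul_norm_powGrad_le (ν := ν) hu hu1 hiso hr
      (K := Real.pi * √q) (by positivity) z
    calc _ = Real.pi * √q * ‖powGrad ν u r z‖ := by ring
      _ ≤ _ := this
      _ = _ := by ring
  refine (lintegral_mono h4).trans (le_of_eq ?_)
  rw [lintegral_const_mul _ (by fun_prop), lintegral_add_right _ measurable_const,
    lintegral_const_mul _ (by fun_prop), lintegral_const, measure_univ, mul_one]

/-- Moments of `powInt` of a Gaussian vector. -/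
lemma lintegral_powInt_rpow_le (hu : Measurable u) (hu1 : ∀ ω, ‖u ω‖ ≤ 1)
    (hiso : ∀ y, ∫ ω, ⟪u ω, y⟫ ^ 2 ∂ν ≤ ‖y‖ ^ 2) (hr : 2 < r) {q : ℝ} (hq : 1 ≤ q)
    {n : ℝ} (hn : 0 ≤ n) (hν : ν Set.univ ≤ ENNReal.ofReal n) :
    ∫⁻ z, ENNReal.ofReal (powInt ν u r z) ^ q ∂(stdGaussian E)
      ≤ ENNReal.ofReal
        (8 * (n * (gaussianAbsMoment r).toReal + (8 * r * (Real.pi * √q)) ^ r)) ^ q := by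
  have hq0 : 0 < q := by linarith
  have hpi := Real.pi_pos
  have hb : 0 ≤ (8 * r * (Real.pi * √q)) ^ r :=
    Real.rpow_nonneg (by nlinarith [mul_nonneg hpi.le (Real.sqrt_nonneg q)]) _
  set b := (8 * r * (Real.pi * √q)) ^ r with hbdef
  have hH : Continuous (powInt ν u r) := continuous_powInt hu hu1 (by linarith)
  set a := ∫ z, powInt ν u r z ∂(stdGaussian E) with ha
  set M := ∫⁻ z, ENNReal.ofReal (powInt ν u r z) ^ q ∂(stdGaussian E) with hM
  have hMtop : M ≠ ∞ := lintegral_powInt_rpow_ne_top hu hu1 hiso hr hq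
  have ha0 : 0 ≤ a := integral_nonneg powInt_nonneg
  have hale : ENNReal.ofReal a ≤ ENNReal.ofReal (n * (gaussianAbsMoment r).toReal) := by
    rw [ha, ofReal_integral_eq_lintegral_ofReal (integrable_powInt_stdGaussian hu hu1 hiso hr)
      (ae_of_all _ powInt_nonneg), ENNReal.ofReal_mul hn,
      ENNReal.ofReal_toReal (gaussianAbsMoment_ne_top (by linarith))]
    refine (lintegral_powInt_stdGaussian_le hu hu1 (by linarith)).trans ?_
    gcongr
  have hdev := lintegral_powInt_sub_integral_le hu hu1 hiso hr hq
  rw [← ha, ← hM, ← hbdef] at hdev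
  have h1 : M ≤ 2 ^ q * (∫⁻ z, ‖powInt ν u r z - a‖ₑ ^ q ∂(stdGaussian E)
      + ENNReal.ofReal a ^ q) := by
    calc M ≤ ∫⁻ z, 2 ^ q * (‖powInt ν u r z - a‖ₑ ^ q + ENNReal.ofReal a ^ q)
          ∂(stdGaussian E) := by
          refine lintegral_mono fun z => le_trans ?_ (ENNReal.add_rpow_le_two_rpow_mul _ _ hq)
          gcongr
          rw [Real.enorm_eq_ofReal_abs, ← ENNReal.ofReal_add (abs_nonneg _) ha0]
          apply ENNReal.ofReal_le_ofReal
          linarith [le_abs_self (powInt ν u r z - a)]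
      _ = _ := by
          rw [lintegral_const_mul _ (by fun_prop), lintegral_add_right _ measurable_const,
            lintegral_const, measure_univ, mul_one]
  have h4 : (2 : ℝ≥0∞) ^ q * 2 ^ q = 4 ^ q := by
    rw [← ENNReal.mul_rpow_of_nonneg _ _ hq0.le]; norm_num
  -- This is the purpose of the factor 1/8 in the gradient estimate: two splittings cost 2^q each,
  -- and 4^q/8^q ≤ 1/2 still lets M be absorbed. Subtracting M/2 below requires M finite.
  have h48 : (4 : ℝ≥0∞) ^ q * 8⁻¹ ^ q ≤ 2⁻¹ := by
    rw [← ENNReal.mul_rpow_of_nonneg _ _ hq0.le]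
    have : (4 : ℝ≥0∞) * 8⁻¹ = 2⁻¹ := by
      rw [show (8 : ℝ≥0∞) = 4 * 2 by norm_num, ENNReal.mul_inv (by simp) (by simp), ← mul_assoc,
        ENNReal.mul_inv_cancel (by norm_num) (by norm_num), one_mul]
    rw [this]
    conv_rhs => rw [← ENNReal.rpow_one 2⁻¹]
    exact ENNReal.rpow_le_rpow_of_exponent_ge (by simp) hq
  have h2 : M ≤ 2⁻¹ * M + 4 ^ q * (ENNReal.ofReal b + ENNReal.ofReal a) ^ q := by
    calc M ≤ 2 ^ q * (2 ^ q * (8⁻¹ ^ q * M + ENNReal.ofReal b ^ q) + ENNReal.ofReal a ^ q) := by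
          refine h1.trans ?_; gcongr
      _ ≤ 2 ^ q * (2 ^ q * (8⁻¹ ^ q * M + ENNReal.ofReal b ^ q)
            + 2 ^ q * ENNReal.ofReal a ^ q) := by
          gcongr
          refine le_mul_of_one_le_left' (ENNReal.one_le_rpow (by norm_num) hq0)
      _ = 4 ^ q * 8⁻¹ ^ q * M + 4 ^ q * (ENNReal.ofReal b ^ q + ENNReal.ofReal a ^ q) := by
          rw [← h4]; ring
      _ ≤ _ := by
          gcongr
          exact ENNReal.add_rpow_le_rpow_add _ _ hq
  have h5 : M ≤ 2 * (4 ^ q * (ENNReal.ofReal b + ENNReal.ofReal a) ^ q) := by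
    have h6 : 2⁻¹ * M ≠ ∞ := ENNReal.mul_ne_top (by simp) hMtop
    have h7 : M = 2⁻¹ * M + 2⁻¹ * M := by rw [← add_mul, ENNReal.inv_two_add_inv_two, one_mul]
    have h8 : 2⁻¹ * M ≤ 4 ^ q * (ENNReal.ofReal b + ENNReal.ofReal a) ^ q := by
      rw [← ENNReal.add_le_add_iff_left h6, ← h7]; exact h2
    calc M = 2 * (2⁻¹ * M) := by
          rw [← mul_assoc, ENNReal.mul_inv_cancel (by norm_num) (by norm_num), one_mul]
      _ ≤ _ := by gcongr
  calc M ≤ 2 ^ q * (4 ^ q * (ENNReal.ofReal b + ENNReal.ofReal a) ^ q) := by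
        refine h5.trans ?_
        gcongr
        conv_lhs => rw [← ENNReal.rpow_one 2]
        exact ENNReal.rpow_le_rpow_of_exponent_le (by norm_num) hq
    _ = (8 * (ENNReal.ofReal b + ENNReal.ofReal a)) ^ q := by
        rw [← mul_assoc, ← ENNReal.mul_rpow_of_nonneg _ _ hq0.le,
          ← ENNReal.mul_rpow_of_nonneg _ _ hq0.le]
        norm_num
    _ ≤ _ := by
        gcongr
        rw [ENNReal.ofReal_mul (by norm_num), ENNReal.ofReal_add (by positivity) hb, add_comm]
        norm_num
        gcongr

end Moments

/-! ### Nets and chaining on the sphere -/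

section Chaining

variable {V : Type*} [NormedAddCommGroup V] [NormedSpace ℝ V] [FiniteDimensional ℝ V]

/-- Volumetric bound on the cardinality of a separated subset of the unit ball. -/
lemma card_le_of_separated_unitBall {r : ℝ} (hr : 0 < r) (s : Finset V) (hs : ∀ c ∈ s, ‖c‖ ≤ 1)
    (h : ∀ c ∈ s, ∀ d ∈ s, c ≠ d → r ≤ ‖c - d‖) :
    (s.card : ℝ) ≤ (1 + 2 / r) ^ Module.finrank ℝ V := by
  borelize V
  let μ : Measure V := Measure.addHaar
  have hδ : 0 < r / 2 := by positivity
  have hρ : 0 < 1 + r / 2 := by positivity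
  have hD : Set.PairwiseDisjoint (s : Set V) (fun c => Metric.ball c (r / 2)) := by
    intro c hc d hd hcd
    apply Metric.ball_disjoint_ball
    rw [dist_eq_norm]
    linarith [h c hc d hd hcd]
  have hsub : (⋃ c ∈ s, Metric.ball c (r / 2)) ⊆ Metric.ball (0 : V) (1 + r / 2) := by
    refine Set.iUnion₂_subset fun x hx => Metric.ball_subset_ball' ?_
    rw [dist_zero_right]
    linarith [hs x hx]
  have hI : (s.card : ℝ≥0∞) * ENNReal.ofReal ((r / 2) ^ Module.finrank ℝ V) * μ (Metric.ball 0 1)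
      ≤ ENNReal.ofReal ((1 + r / 2) ^ Module.finrank ℝ V) * μ (Metric.ball 0 1) :=
    calc _ = μ (⋃ c ∈ s, Metric.ball c (r / 2)) := by
          rw [measure_biUnion_finset hD fun c _ => measurableSet_ball]
          simp only [μ.addHaar_ball_of_pos _ hδ, Finset.sum_const, nsmul_eq_mul, mul_assoc]
      _ ≤ μ (Metric.ball (0 : V) (1 + r / 2)) := measure_mono hsub
      _ = _ := by simp only [μ.addHaar_ball_of_pos _ hρ]
  have hJ := (ENNReal.mul_le_mul_iff_left
    (Metric.measure_ball_pos μ (0 : V) zero_lt_one).ne' measure_ball_lt_top.ne).1 hI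
  have hK := ENNReal.toReal_le_of_le_ofReal (by positivity) hJ
  rw [ENNReal.toReal_mul, ENNReal.toReal_natCast, ENNReal.toReal_ofReal (by positivity)] at hK
  rw [show 1 + 2 / r = (1 + r / 2) / (r / 2) by field_simp; ring, div_pow, le_div_iff₀ (by positivity)]
  exact hK

/-- A separated subset of the sphere of largest cardinality is a net; the volumetric bound
guarantees that a largest one exists. -/
lemma exists_finset_net_sphere {r : ℝ} (hr : 0 < r) :
    ∃ N : Finset V, (∀ x ∈ N, ‖x‖ = 1) ∧ (∀ x : V, ‖x‖ = 1 → ∃ y ∈ N, ‖y - x‖ ≤ r) ∧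
      (N.card : ℝ) ≤ (1 + 2 / r) ^ Module.finrank ℝ V := by
  classical
  let Q : Finset V → Prop := fun N =>
    (∀ x ∈ N, ‖x‖ = 1) ∧ ∀ c ∈ N, ∀ d ∈ N, c ≠ d → r ≤ ‖c - d‖
  have hb : ∀ N, Q N → (N.card : ℝ) ≤ (1 + 2 / r) ^ Module.finrank ℝ V := fun N hN =>
    card_le_of_separated_unitBall hr N (fun c hc => (hN.1 c hc).le) hN.2
  let b := ⌊(1 + 2 / r) ^ Module.finrank ℝ V⌋₊
  have hb' : ∀ N, Q N → N.card ≤ b := fun N hN => Nat.le_floor (hb N hN)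
  have h0 : ∃ N : Finset V, Q N ∧ N.card = 0 := ⟨∅, ⟨by simp, by simp⟩, rfl⟩
  obtain ⟨N, hN, hNc⟩ := Nat.findGreatest_spec (P := fun m => ∃ N : Finset V, Q N ∧ N.card = m)
    (Nat.zero_le b) h0
  refine ⟨N, hN.1, fun x hx => ?_, hb N hN⟩
  by_contra! hcon
  have hxN : x ∉ N := fun hxN => by
    have := hcon x hxN
    rw [sub_self, norm_zero] at this
    linarith
  have hQ : Q (insert x N) := by
    refine ⟨fun y hy => ?_, fun c hc d hd hcd => ?_⟩
    · rcases Finset.mem_insert.1 hy with rfl | hy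
      · exact hx
      · exact hN.1 y hy
    · rcases Finset.mem_insert.1 hc with rfl | hc' <;> rcases Finset.mem_insert.1 hd with rfl | hd'
      · exact absurd rfl hcd
      · rw [norm_sub_rev]; exact (hcon d hd').le
      · exact (hcon c hc').le
      · exact hN.2 c hc' d hd' hcd
  have := Nat.le_findGreatest (P := fun m => ∃ N : Finset V, Q N ∧ N.card = m)
    (hb' _ hQ) ⟨_, hQ, rfl⟩
  rw [← hNc, Finset.card_insert_of_notMem hxN] at this
  omega

lemma measure_enorm_ge_le {Ω : Type*} [MeasurableSpace Ω] {P : Measure Ω} {g : Ω → ℝ}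
    (hg : Measurable g) {m : ℕ} {c d : ℝ} (hc : 0 < c) (hd : 0 ≤ d)
    (h : ∫⁻ ω, ‖g ω‖ₑ ^ m ∂P ≤ ENNReal.ofReal d ^ m) :
    P {ω | c ≤ |g ω|} ≤ ENNReal.ofReal ((d / c) ^ m) := by
  have hsub : {ω | c ≤ |g ω|} ⊆ {ω | ENNReal.ofReal c ^ m ≤ ‖g ω‖ₑ ^ m} := by
    intro ω hω
    rw [Set.mem_ofPred_eq, Real.enorm_eq_ofReal_abs]
    exact pow_le_pow_left' (ENNReal.ofReal_le_ofReal hω) m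
  refine (measure_mono hsub).trans ?_
  have hc' : ENNReal.ofReal c ^ m ≠ 0 := pow_ne_zero _ (by simpa using hc)
  refine (meas_ge_le_lintegral_div (hg.enorm.pow_const m).aemeasurable hc' (by simp)).trans ?_
  rw [div_pow, ENNReal.ofReal_div_of_pos (by positivity), ENNReal.ofReal_pow hd,
    ENNReal.ofReal_pow hc.le]
  gcongr

/-- Kolmogorov chaining over the unit sphere: if the increments of a random function are Lipschitz
in `L_q` with `q = 8 k`, `k` the dimension, then the oscillation on the sphere is of the order of
the Lipschitz constant. -/
theorem measure_exists_increment_gt_le {Ω : Type*} [MeasurableSpace Ω] {P : Measure Ω} {k : ℕ}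
    (hk : Module.finrank ℝ V = k) (hk0 : k ≠ 0) {f : Ω → V → ℝ}
    (hmeas : ∀ x, Measurable fun ω => f ω x) (hcont : ∀ ω, Continuous (f ω)) {B : ℝ} (hB : 0 < B)
    (hinc : ∀ x y, ‖x‖ = 1 → ‖y‖ = 1 →
      ∫⁻ ω, ‖f ω x - f ω y‖ₑ ^ (8 * k) ∂P ≤ ENNReal.ofReal (B * ‖x - y‖) ^ (8 * k))
    {a : V} (ha : ‖a‖ = 1) :
    P {ω | ∃ x, ‖x‖ = 1 ∧ 32 * B < |f ω x - f ω a|} ≤ ENNReal.ofReal (1 / 2000) := by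
  classical
  choose N₀ hN₀1 hN₀2 hN₀3 using fun j : ℕ =>
    exists_finset_net_sphere (V := V) (r := 2 * (1 / 4 : ℝ) ^ j) (by positivity)
  -- The sphere has diameter 2, so {a} is a net at level 0; every chain then starts at a.
  let N : ℕ → Finset V := fun j => if j = 0 then {a} else N₀ j
  have hN1 : ∀ j, ∀ x ∈ N j, ‖x‖ = 1 := by
    intro j x hx
    by_cases hj : j = 0
    · simp only [N, hj, if_true, Finset.mem_singleton] at hx; rw [hx, ha]
    · simp only [N, hj, if_false] at hx; exact hN₀1 j x hx
  have hN2 : ∀ j, ∀ x : V, ‖x‖ = 1 → ∃ y ∈ N j, ‖y - x‖ ≤ 2 * (1 / 4 : ℝ) ^ j := by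
    intro j x hx
    by_cases hj : j = 0
    · refine ⟨a, by simp [N, hj], ?_⟩
      rw [hj, pow_zero]
      linarith [norm_sub_le a x]
    · obtain ⟨y, hy, hyx⟩ := hN₀2 j x hx
      exact ⟨y, by simpa [N, hj] using hy, hyx⟩
  have hN3 : ∀ j, ((N j).card : ℝ) ≤ (2 * 4 ^ j) ^ k := by
    intro j
    by_cases hj : j = 0
    · simp only [N, hj, if_true, Finset.card_singleton, pow_zero, mul_one, Nat.cast_one]
      exact one_le_pow₀ (by norm_num)
    · simp only [N, hj, if_false]
      refine (hN₀3 j).trans ?_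
      rw [hk]
      refine pow_le_pow_left₀ (by positivity) ?_ _
      have h4 : (1 : ℝ) ≤ 4 ^ j := one_le_pow₀ (by norm_num)
      rw [one_div, inv_pow, div_mul_eq_div_div, div_inv_eq_mul]
      linarith
  -- Links at level j have length at most 3·4^(-j), while the thresholds decay only like 2^(-j) and
  -- sum to 32B; Markov thus gains (3/16·2^(-j))^(8k) for each link.
  let bad : ℕ → V × V → Set Ω := fun j xy => {ω | 16 * B * (1 / 2) ^ j ≤ |f ω xy.1 - f ω xy.2|}
  let pairs : ℕ → Finset (V × V) := fun j =>
    ((N j) ×ˢ (N (j + 1))).filter fun xy => ‖xy.1 - xy.2‖ ≤ 3 * (1 / 4 : ℝ) ^ j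
  have hbad : ∀ j, ∀ xy ∈ pairs j,
      P (bad j xy) ≤ ENNReal.ofReal ((3 / 16 * (1 / 2) ^ j) ^ (8 * k)) := by
    intro j xy hxy
    obtain ⟨h1, h2⟩ := Finset.mem_filter.1 hxy
    obtain ⟨hx, hy⟩ := Finset.mem_product.1 h1
    have hle : ∫⁻ ω, ‖f ω xy.1 - f ω xy.2‖ₑ ^ (8 * k) ∂P
        ≤ ENNReal.ofReal (B * (3 * (1 / 4 : ℝ) ^ j)) ^ (8 * k) := by
      refine (hinc _ _ (hN1 _ _ hx) (hN1 _ _ hy)).trans ?_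
      gcongr
    have h3 := measure_enorm_ge_le ((hmeas xy.1).sub (hmeas xy.2))
      (c := 16 * B * (1 / 2) ^ j) (by positivity) (by positivity) hle
    refine h3.trans (le_of_eq ?_)
    congr 2
    rw [show (1 / 4 : ℝ) = 1 / 2 * (1 / 2) by norm_num, mul_pow]
    field_simp
  have hcard : ∀ j, ((pairs j).card : ℝ) ≤ (16 * 16 ^ j) ^ k := by
    intro j
    have h1 : ((pairs j).card : ℝ) ≤ ((N j).card : ℝ) * (N (j + 1)).card := by
      rw [← Nat.cast_mul, ← Finset.card_product]
      exact_mod_cast Finset.card_filter_le _ _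
    refine h1.trans ((mul_le_mul (hN3 j) (hN3 (j + 1)) (by positivity) (by positivity)).trans ?_)
    rw [← mul_pow]
    refine pow_le_pow_left₀ (by positivity) (le_of_eq ?_) _
    rw [show (16 : ℝ) ^ j = 4 ^ j * 4 ^ j by rw [← mul_pow]; norm_num]
    ring
  -- The exponent 8k gives a decay 256^(-jk) against 16^(jk) pairs up to constants. The quantity
  -- raised to the power k is below 1, so k ≠ 0 allows the power to be dropped.
  have hlevel : ∀ j, P (⋃ xy ∈ pairs j, bad j xy) ≤ ENNReal.ofReal (1 / 4000 * (1 / 2) ^ j) := by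
    intro j
    calc P (⋃ xy ∈ pairs j, bad j xy) ≤ ∑ xy ∈ pairs j, P (bad j xy) :=
          measure_biUnion_finset_le _ _
      _ ≤ ∑ _xy ∈ pairs j, ENNReal.ofReal ((3 / 16 * (1 / 2) ^ j) ^ (8 * k)) :=
          Finset.sum_le_sum (hbad j)
      _ = ENNReal.ofReal ((pairs j).card * (3 / 16 * (1 / 2) ^ j) ^ (8 * k)) := by
          rw [Finset.sum_const, nsmul_eq_mul, ENNReal.ofReal_mul (by positivity),
            ENNReal.ofReal_natCast]
      _ ≤ _ := by
          apply ENNReal.ofReal_le_ofReal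
          have h2 : ((pairs j).card : ℝ) * (3 / 16 * (1 / 2) ^ j) ^ (8 * k)
              ≤ (16 * (3 / 16) ^ 8 * (1 / 16) ^ j) ^ k := by
            calc _ ≤ (16 * 16 ^ j) ^ k * ((3 / 16 * (1 / 2) ^ j) ^ (8 * k) : ℝ) := by
                  gcongr; exact hcard j
              _ = (16 * 16 ^ j * (3 / 16 * (1 / 2) ^ j) ^ 8) ^ k := by
                  rw [pow_mul, ← mul_pow]
              _ = _ := by
                  congr 1
                  rw [mul_pow, ← pow_mul, mul_comm j 8, pow_mul,
                    show (1 / 16 : ℝ) = 16 * (1 / 2) ^ 8 by norm_num, mul_pow]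
                  ring
          have h16 : (1 / 16 : ℝ) ^ j ≤ (1 / 2) ^ j :=
            pow_le_pow_left₀ (by norm_num) (by norm_num) _
          have h1 : (1 / 16 : ℝ) ^ j ≤ 1 := pow_le_one₀ (by norm_num) (by norm_num)
          have hpos : (0 : ℝ) ≤ (1 / 16) ^ j := by positivity
          refine h2.trans ((pow_le_of_le_one (by positivity) ?_ hk0).trans ?_)
          · nlinarith
          · have h3 : (16 * (3 / 16) ^ 8 : ℝ) ≤ 1 / 4000 := by norm_num
            exact mul_le_mul h3 h16 hpos (by norm_num)
  have hall : P (⋃ j, ⋃ xy ∈ pairs j, bad j xy) ≤ ENNReal.ofReal (1 / 2000) := by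
    refine (measure_iUnion_le _).trans ((ENNReal.tsum_le_tsum hlevel).trans (le_of_eq ?_))
    rw [← ENNReal.ofReal_tsum_of_nonneg (fun j => by positivity)
      ((summable_geometric_two).mul_left _), tsum_mul_left, tsum_geometric_two]
    norm_num
  refine (measure_mono ?_).trans hall
  rintro ω ⟨x, hx, hbig⟩
  by_contra hcon
  simp only [Set.mem_iUnion, not_exists] at hcon
  choose y hyN hyx using fun j => hN2 j x hx
  have htend : Filter.Tendsto y Filter.atTop (nhds x) := by
    rw [tendsto_iff_norm_sub_tendsto_zero]
    refine squeeze_zero (fun _ => norm_nonneg _) hyx ?_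
    simpa using (tendsto_pow_atTop_nhds_zero_of_lt_one (r := (1 / 4 : ℝ)) (by norm_num)
      (by norm_num)).const_mul 2
  -- Outside all bad events the increments along the chain from a to x are summable with total 32B,
  -- and continuity of the sample function reaches x itself.
  have hstep : ∀ j, dist (f ω (y j)) (f ω (y (j + 1))) ≤ 32 * B / 2 / 2 ^ j := by
    intro j
    have hmem : (y j, y (j + 1)) ∈ pairs j := by
      refine Finset.mem_filter.2 ⟨Finset.mem_product.2 ⟨hyN j, hyN (j + 1)⟩, ?_⟩
      have h1 := hyx j
      have h2 := hyx (j + 1)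
      have h3 : ‖y j - y (j + 1)‖ ≤ ‖y j - x‖ + ‖y (j + 1) - x‖ := by
        rw [← norm_neg (y (j + 1) - x)]
        refine le_of_eq_of_le ?_ (norm_add_le _ _)
        congr 1; abel
      have h4 : (0 : ℝ) ≤ (1 / 4) ^ j := by positivity
      rw [pow_succ] at h2
      simp only
      linarith
    have h5 := hcon j (y j, y (j + 1)) hmem
    simp only [bad, Set.mem_ofPred_eq, not_le] at h5
    rw [Real.dist_eq]
    refine h5.le.trans (le_of_eq ?_)
    rw [one_div, inv_pow]; field_simp; norm_num
  have h6 := dist_le_of_le_geometric_two_of_tendsto₀ hstep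
    (((hcont ω).tendsto x).comp htend)
  have hy0 : y 0 = a := by simpa [N] using hyN 0
  rw [hy0, dist_comm, Real.dist_eq] at h6
  linarith

end Chaining

/-! ### Lewis' change of density by maximizing a determinant -/

section Lewis

lemma Lp.norm_rpow_eq_integral_norm_rpow {Ω F : Type*} [MeasurableSpace Ω] {μ : Measure Ω}
    [NormedAddCommGroup F] {p : ℝ} (hp : 0 < p) (h : Lp F (ENNReal.ofReal p) μ) :
    ‖h‖ ^ p = ∫ ω, ‖h ω‖ ^ p ∂μ := by
  have h0 : 0 ≤ ∫ ω, ‖h ω‖ ^ p ∂μ := integral_nonneg fun _ => by positivity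
  rw [Lp.norm_def, MemLp.eLpNorm_eq_integral_rpow_norm (by simpa using hp) ENNReal.ofReal_ne_top
    (Lp.memLp h), ENNReal.toReal_ofReal hp.le, ENNReal.toReal_ofReal (by positivity),
    ← Real.rpow_mul h0, inv_mul_cancel₀ hp.ne', Real.rpow_one]

lemma Lp.integrable_norm_rpow {Ω F : Type*} [MeasurableSpace Ω] {μ : Measure Ω}
    [NormedAddCommGroup F] {p : ℝ} (hp : 0 < p) (h : Lp F (ENNReal.ofReal p) μ) :
    Integrable (fun ω => ‖h ω‖ ^ p) μ := by
  have := (Lp.memLp h).integrable_norm_rpow (by simpa using hp) ENNReal.ofReal_ne_top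
  rwa [ENNReal.toReal_ofReal hp.le] at this

variable {Ω : Type*} [MeasurableSpace Ω] {μ : Measure Ω} {E : Type*} [NormedAddCommGroup E]
  [InnerProductSpace ℝ E]

/-- First variation of the p-th power of the norm under the rank-one perturbation id + t y⊗y of the
identity, used at the determinant maximum. -/
lemma hasDerivAt_integral_norm_add_smul_rpow {p : ℝ} (hp : 2 < p)
    (g : Lp E (ENNReal.ofReal p) μ) (y : E) :
    HasDerivAt (fun t : ℝ => ∫ ω, ‖g ω + t • (⟪y, g ω⟫ • y)‖ ^ p ∂μ)
      (p * ∫ ω, ‖g ω‖ ^ (p - 2) * ⟪y, g ω⟫ ^ 2 ∂μ) 0 := by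
  have hg := Lp.aestronglyMeasurable g
  have hgi := Lp.integrable_norm_rpow (by linarith : 0 < p) g
  have hyg : AEStronglyMeasurable (fun ω => ⟪y, g ω⟫) μ := hg.const_inner
  have hw : AEStronglyMeasurable (fun ω => ⟪y, g ω⟫ • y) μ := hyg.smul_const y
  set c := 1 + ‖y‖ ^ 2 with hc
  have hc1 : 1 ≤ c := by rw [hc]; nlinarith [sq_nonneg ‖y‖]
  have hwle : ∀ ω, ‖⟪y, g ω⟫ • y‖ ≤ c * ‖g ω‖ := by
    intro ω
    rw [norm_smul]
    calc _ ≤ ‖y‖ * ‖g ω‖ * ‖y‖ := by gcongr; exact norm_inner_le_norm _ _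
      _ ≤ _ := by rw [hc]; nlinarith [norm_nonneg (g ω)]
  have hle : ∀ ω, ∀ t ∈ Metric.ball (0 : ℝ) 1, ‖g ω + t • (⟪y, g ω⟫ • y)‖ ≤ 2 * c * ‖g ω‖ := by
    intro ω t ht
    rw [mem_ball_zero_iff] at ht
    calc _ ≤ ‖g ω‖ + ‖t‖ * ‖⟪y, g ω⟫ • y‖ := by
          rw [← norm_smul]; exact norm_add_le _ _
      _ ≤ c * ‖g ω‖ + 1 * (c * ‖g ω‖) := by
          gcongr
          · exact le_mul_of_one_le_left (norm_nonneg _) hc1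
          · exact hwle ω
      _ = _ := by ring
  have hrp : ∀ s : ℝ, 0 ≤ s → s ^ (p - 2) * s * s = s ^ p := fun s hs => by
    rw [mul_assoc, ← sq, ← Real.rpow_natCast s 2,
      ← Real.rpow_add_of_nonneg hs (by linarith) (by norm_num)]
    congr 1; push_cast; ring
  have hmeasF : ∀ t : ℝ, AEStronglyMeasurable (fun ω => g ω + t • (⟪y, g ω⟫ • y)) μ :=
    fun t => hg.add (hw.const_smul t)
  have hcr : ∀ r : ℝ, 0 ≤ r → Continuous fun s : ℝ => s ^ r := fun r hr =>
    Real.continuous_rpow_const hr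
  have key := (hasDerivAt_integral_of_dominated_loc_of_deriv_le (μ := μ)
    (F := fun (t : ℝ) ω => ‖g ω + t • (⟪y, g ω⟫ • y)‖ ^ p)
    (F' := fun (t : ℝ) ω => p * ‖g ω + t • (⟪y, g ω⟫ • y)‖ ^ (p - 2) *
      ⟪g ω + t • (⟪y, g ω⟫ • y), ⟪y, g ω⟫ • y⟫)
    (bound := fun ω => p * (2 * c) ^ p * ‖g ω‖ ^ p)
    (Metric.ball_mem_nhds (0 : ℝ) one_pos)
    (Filter.Eventually.of_forall fun t =>
      (hcr p (by linarith)).comp_aestronglyMeasurable (hmeasF t).norm)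
    (by simpa using hgi)
    ((((hcr (p - 2) (by linarith)).comp_aestronglyMeasurable (hmeasF 0).norm).const_mul p).mul
      ((hmeasF 0).inner hw))
    (ae_of_all _ fun ω t ht => ?_) (hgi.const_mul _) (ae_of_all _ fun ω t _ => ?_)).2
  · refine key.congr_deriv ?_
    rw [← integral_const_mul]
    refine integral_congr_ae (ae_of_all _ fun ω => ?_)
    simp only [zero_smul, add_zero, real_inner_smul_right, real_inner_comm]
    ring
  · have h1 := hle ω t ht
    have h2 : ‖⟪y, g ω⟫ • y‖ ≤ 2 * c * ‖g ω‖ := by nlinarith [hwle ω, norm_nonneg (g ω)]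
    rw [norm_mul, norm_mul, Real.norm_of_nonneg (by linarith : 0 ≤ p),
      Real.norm_of_nonneg (by positivity)]
    calc _ ≤ p * (2 * c * ‖g ω‖) ^ (p - 2) * (2 * c * ‖g ω‖ * (2 * c * ‖g ω‖)) := by
          gcongr
          exact (norm_inner_le_norm _ _).trans (by gcongr)
      _ = p * ((2 * c * ‖g ω‖) ^ (p - 2) * (2 * c * ‖g ω‖) * (2 * c * ‖g ω‖)) := by ring
      _ = _ := by
          rw [hrp _ (by positivity), Real.mul_rpow (by positivity) (norm_nonneg _)]; ring
  · have h1 := hasFDerivAt_norm_rpow (g ω + t • (⟪y, g ω⟫ • y)) (p := p) (by linarith)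
    have h2 : HasDerivAt (fun t : ℝ => g ω + t • (⟪y, g ω⟫ • y)) (⟪y, g ω⟫ • y) t := by
      simpa using ((hasDerivAt_id t).smul_const (⟪y, g ω⟫ • y)).const_add (g ω)
    exact h1.comp_hasDerivAt t h2

variable [FiniteDimensional ℝ E]

/-- Existence of a transformation of maximal determinant among those of norm at most one. -/
lemma exists_det_le_norm_compLp_pow {q : ℝ≥0∞} [Fact (1 ≤ q)] (f : Lp E q μ)
    (hE : Module.finrank ℝ E ≠ 0) (hf : ∀ y : E, (innerSL ℝ y).compLp f = 0 → y = 0) :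
    ∃ A : E →L[ℝ] E, ‖A.compLp f‖ = 1 ∧
      ∀ T : E →L[ℝ] E, T.det ≤ ‖T.compLp (A.compLp f)‖ ^ Module.finrank ℝ E := by
  set n := Module.finrank ℝ E with hn
  let Λ : (E →L[ℝ] E) →ₗ[ℝ] Lp E q μ :=
    { toFun := fun A => A.compLp f
      map_add' := fun A B => ContinuousLinearMap.add_compLp A B f
      map_smul' := fun c A => ContinuousLinearMap.smul_compLp c A f }
  have hΛ : ∀ A, Λ A = A.compLp f := fun _ => rfl
  have hcomp : ∀ T A : E →L[ℝ] E, T.compLp (A.compLp f) = Λ (T ∘L A) := by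
    intro T A
    apply Lp.ext
    filter_upwards [T.coeFn_compLp (A.compLp f), A.coeFn_compLp f, (T ∘L A).coeFn_compLp f]
      with ω h1 h2 h3
    rw [h1, h2, hΛ, h3, ContinuousLinearMap.comp_apply]
  -- Since no nonzero functional annihilates f, ‖Λ A‖ is a norm on operators, whose unit ball is
  -- compact.
  have hinj : Function.Injective Λ := by
    rw [← LinearMap.ker_eq_bot, LinearMap.ker_eq_bot']
    intro A hA
    have h1 : ∀ y, ContinuousLinearMap.adjoint A y = 0 := by
      intro y
      apply hf
      rw [hΛ] at hA
      apply Lp.ext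
      filter_upwards [(innerSL ℝ (ContinuousLinearMap.adjoint A y)).coeFn_compLp f,
        A.coeFn_compLp f, Lp.coeFn_zero ℝ q μ, Lp.coeFn_zero E q μ] with ω h1 h2 h3 h4
      rw [h1, h3, Pi.zero_apply, innerSL_apply_apply, ContinuousLinearMap.adjoint_inner_left, ← h2,
        hA, h4, Pi.zero_apply, inner_zero_right]
    have h2 : ContinuousLinearMap.adjoint A = 0 := by ext y; simp [h1]
    simpa using h2
  obtain ⟨K, -, hK⟩ := (LinearMap.injective_iff_antilipschitz Λ).1 hinj
  have hcont : Continuous Λ := Λ.continuous_of_finiteDimensional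
  have : ProperSpace (E →L[ℝ] E) := FiniteDimensional.proper ℝ _
  have hcpt : IsCompact {A : E →L[ℝ] E | ‖Λ A‖ ≤ 1} := by
    refine Metric.isCompact_of_isClosed_isBounded
      (isClosed_le hcont.norm continuous_const) ?_
    refine isBounded_iff_forall_norm_le.2 ⟨K, fun A hA => ?_⟩
    have := hK.le_mul_dist A 0
    rw [dist_zero_right, map_zero, dist_zero_right] at this
    exact this.trans (mul_le_of_le_one_right K.2 hA)
  obtain ⟨A, hA, hmax⟩ := hcpt.exists_isMaxOn ⟨0, by simp⟩
    (ContinuousLinearMap.continuous_det (𝕜 := ℝ) (E := E)).continuousOn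
  have hsmul : ∀ (c : ℝ) (T : E →L[ℝ] E), (c • T).det = c ^ n * T.det := fun c T => by
    simp [ContinuousLinearMap.det, LinearMap.det_smul, hn]
  have hmul : ∀ T B : E →L[ℝ] E, (T ∘L B).det = T.det * B.det := fun T B => by
    simp [ContinuousLinearMap.det]
  have hid : (ContinuousLinearMap.id ℝ E).det = 1 := by simp [ContinuousLinearMap.det]
  have hpos : 0 < A.det := by
    set s : ℝ := (‖Λ (ContinuousLinearMap.id ℝ E)‖ + 1)⁻¹ with hs
    have hs0 : 0 < s := by positivity
    have hmem : s • ContinuousLinearMap.id ℝ E ∈ {A : E →L[ℝ] E | ‖Λ A‖ ≤ 1} := by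
      rw [Set.mem_ofPred_eq, map_smul, norm_smul, Real.norm_of_nonneg hs0.le, hs,
        inv_mul_le_one₀ (by positivity)]
      linarith
    have h1 := hmax hmem
    simp only [Set.mem_ofPred_eq, hsmul, hid, mul_one] at h1
    exact lt_of_lt_of_le (by positivity) h1
  have hext : ∀ T : E →L[ℝ] E, T.det ≤ ‖T.compLp (A.compLp f)‖ ^ n := by
    intro T
    rw [hcomp]
    rcases eq_or_ne (Λ (T ∘L A)) 0 with h0 | h0
    · have h1 : T ∘L A = 0 := hinj (by rw [h0, map_zero])
      have h2 : T.det * A.det = 0 := by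
        rw [← hmul, h1, ← zero_smul ℝ (ContinuousLinearMap.id ℝ E), hsmul, zero_pow hE, zero_mul]
      rw [(mul_eq_zero.1 h2).resolve_right hpos.ne']
      positivity
    · have hN : 0 < ‖Λ (T ∘L A)‖ := norm_pos_iff.2 h0
      have hmem : ‖Λ (T ∘L A)‖⁻¹ • (T ∘L A) ∈ {A : E →L[ℝ] E | ‖Λ A‖ ≤ 1} := by
        rw [Set.mem_ofPred_eq, map_smul, norm_smul, norm_inv, norm_norm, inv_mul_cancel₀ hN.ne']
      have h1 := hmax hmem
      simp only [Set.mem_ofPred_eq, hsmul, hmul, inv_pow] at h1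
      rw [inv_mul_le_iff₀ (by positivity)] at h1
      exact le_of_mul_le_mul_right h1 hpos
  refine ⟨A, le_antisymm hA ?_, hext⟩
  have h1 := hext (ContinuousLinearMap.id ℝ E)
  rw [hcomp, hid, ContinuousLinearMap.id_comp] at h1
  by_contra hlt
  rw [not_le] at hlt
  exact absurd h1 (not_le.2 (pow_lt_one₀ (norm_nonneg _) hlt hE))

/-- The isotropy condition satisfied at a maximum of the determinant. -/
lemma integral_isotropic_of_det_le {p : ℝ} (hp : 2 < p) (g : Lp E (ENNReal.ofReal p) μ)
    (hg : ‖g‖ = 1)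
    (hdet : ∀ T : E →L[ℝ] E, T.det ≤ ‖T.compLp g‖ ^ Module.finrank ℝ E) (y : E) :
    (Module.finrank ℝ E) * ∫ ω, ‖g ω‖ ^ (p - 2) * ⟪y, g ω⟫ ^ 2 ∂μ = ‖y‖ ^ 2 := by
  have hp0 : 0 < p := by linarith
  set n := Module.finrank ℝ E
  let Ψ : ℝ → ℝ := fun t => ∫ ω, ‖g ω + t • (⟪y, g ω⟫ • y)‖ ^ p ∂μ
  have hΨ0 : Ψ 0 = 1 := by
    simp only [Ψ, zero_smul, add_zero]
    rw [← Lp.norm_rpow_eq_integral_norm_rpow hp0, hg, Real.one_rpow]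
  -- The perturbation id + t y⊗y is a transvection of determinant 1 + t‖y‖². Equality holds at t =
  -- 0, so the derivatives of both sides agree there, which is isotropy.
  have hlow : ∀ t : ℝ, 1 + t * ‖y‖ ^ 2 ≤ Ψ t ^ ((n : ℝ) / p) := by
    intro t
    let T : E →L[ℝ] E := ContinuousLinearMap.id ℝ E + t • (innerSL ℝ y).smulRight y
    have hTdet : T.det = 1 + t * ‖y‖ ^ 2 := by
      have : (T : E →ₗ[ℝ] E)
          = LinearMap.transvection ((innerSL ℝ y : E →L[ℝ] ℝ) : E →ₗ[ℝ] ℝ) (t • y) := by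
        ext x
        simp [T, LinearMap.transvection.apply, smul_smul, mul_comm]
      rw [ContinuousLinearMap.det, this, LinearMap.transvection.det]
      simp
    have hTn : ‖T.compLp g‖ ^ p = Ψ t := by
      rw [Lp.norm_rpow_eq_integral_norm_rpow hp0]
      refine integral_congr_ae ?_
      filter_upwards [T.coeFn_compLp g] with ω hω
      rw [hω]
      simp [T]
    have hN : 0 ≤ ‖T.compLp g‖ := by
      rw [Lp.norm_def]; exact ENNReal.toReal_nonneg
    rw [← hTdet, ← hTn, ← Real.rpow_mul hN, mul_div_cancel₀ _ hp0.ne',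
      Real.rpow_natCast]
    exact hdet T
  have hder := ((hasDerivAt_integral_norm_add_smul_rpow hp g y).rpow_const (p := (n : ℝ) / p)
    (Or.inl (by rw [show (∫ ω, ‖g ω + (0 : ℝ) • (⟪y, g ω⟫ • y)‖ ^ p ∂μ) = 1 from hΨ0]; simp))).sub
    (((hasDerivAt_id (0 : ℝ)).mul_const (‖y‖ ^ 2)).const_add 1)
  have hmin : IsLocalMin ((fun t : ℝ => Ψ t ^ ((n : ℝ) / p)) - fun t => 1 + id t * ‖y‖ ^ 2) 0 := by
    refine Filter.Eventually.of_forall fun t => ?_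
    simp only [Pi.sub_apply, hΨ0, Real.one_rpow, id_eq, zero_mul, add_zero, sub_self]
    linarith [hlow t]
  have h0 := hmin.hasDerivAt_eq_zero hder
  rw [show (∫ ω, ‖g ω + (0 : ℝ) • (⟪y, g ω⟫ • y)‖ ^ p ∂μ) = 1 from hΨ0, Real.one_rpow] at h0
  field_simp at h0
  linarith

/-- Lewis' change of density, for a Lebesgue space of vector-valued functions. -/
lemma exists_isotropic_of_det_le [MeasurableSpace E] [BorelSpace E] {p : ℝ} (hp : 2 < p)
    (g : Lp E (ENNReal.ofReal p) μ) (hg : ‖g‖ = 1)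
    (hdet : ∀ T : E →L[ℝ] E, T.det ≤ ‖T.compLp g‖ ^ Module.finrank ℝ E) :
    ∃ (ν : Measure Ω) (u : Ω → E), Measurable u ∧ (∀ ω, ‖u ω‖ ≤ 1) ∧
      ν Set.univ = ENNReal.ofReal (Module.finrank ℝ E) ∧
      (∀ y, ∫ ω, ⟪u ω, y⟫ ^ 2 ∂ν = ‖y‖ ^ 2) ∧
      ∀ y, ∫ ω, |⟪u ω, y⟫| ^ p ∂ν = (Module.finrank ℝ E) * ∫ ω, |⟪y, g ω⟫| ^ p ∂μ := by
  have hp0 : 0 < p := by linarith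
  set n := Module.finrank ℝ E
  have hgm : Measurable g := (Lp.stronglyMeasurable g).measurable
  -- The density n‖g‖^p compensates for normalizing g to u = g/‖g‖, and has mass n because ‖g‖ = 1
  -- in L_p. Where g vanishes, so does the density.
  let ρ : Ω → ℝ≥0∞ := fun ω => ENNReal.ofReal (n * ‖g ω‖ ^ p)
  have hρm : Measurable ρ := by
    have : Measurable fun ω => ‖g ω‖ ^ p := hgm.norm.pow_const p
    fun_prop
  have hρr : ∀ ω, (ρ ω).toReal = n * ‖g ω‖ ^ p := fun ω =>
    ENNReal.toReal_ofReal (by positivity)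
  have hint : ∀ h : Ω → ℝ, ∫ ω, h ω ∂(μ.withDensity ρ) = ∫ ω, n * ‖g ω‖ ^ p * h ω ∂μ := by
    intro h
    rw [integral_withDensity_eq_integral_toReal_smul hρm
      (ae_of_all _ fun ω => ENNReal.ofReal_lt_top)]
    simp_rw [hρr, smul_eq_mul]
  refine ⟨μ.withDensity ρ, fun ω => ‖g ω‖⁻¹ • g ω, by fun_prop, fun ω => ?_, ?_, fun y => ?_,
    fun y => ?_⟩
  · rw [norm_smul, norm_inv, norm_norm]
    exact inv_mul_le_one
  · rw [withDensity_apply _ MeasurableSet.univ, Measure.restrict_univ,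
      ← ofReal_integral_eq_lintegral_ofReal ((Lp.integrable_norm_rpow hp0 g).const_mul _)
        (ae_of_all _ fun ω => by positivity), integral_const_mul,
      ← Lp.norm_rpow_eq_integral_norm_rpow hp0, hg, Real.one_rpow, mul_one]
  · rw [hint, ← integral_isotropic_of_det_le hp g hg hdet y, ← integral_const_mul]
    congr 1
    ext ω
    rcases eq_or_ne (g ω) 0 with h0 | h0
    · simp [h0]
    · have hn0 : 0 < ‖g ω‖ := norm_pos_iff.2 h0
      rw [real_inner_smul_left, real_inner_comm, Real.rpow_sub hn0, Real.rpow_two]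
      field_simp
      exact mul_comm _ _
  · rw [hint, ← integral_const_mul]
    congr 1
    ext ω
    rcases eq_or_ne (g ω) 0 with h0 | h0
    · simp [h0, hp0.ne']
    · have hn0 : 0 < ‖g ω‖ := norm_pos_iff.2 h0
      rw [real_inner_smul_left, real_inner_comm, abs_mul, abs_inv, abs_norm,
        Real.mul_rpow (by positivity) (abs_nonneg _), Real.inv_rpow hn0.le]
      field_simp

/-- Lewis' theorem: a finite-dimensional subspace of `L_p` has an isotropic representation. -/
theorem exists_isotropic_representation {p : ℝ} (hp : 2 < p) {n : ℕ} (hn : n ≠ 0)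
    (X : Submodule ℝ (Lp ℝ (ENNReal.ofReal p) μ)) [FiniteDimensional ℝ X]
    (hX : Module.finrank ℝ X = n) :
    ∃ (ν : Measure Ω) (u : Ω → EuclideanSpace ℝ (Fin n)) (J : EuclideanSpace ℝ (Fin n) →ₗ[ℝ] X),
      Measurable u ∧ (∀ ω, ‖u ω‖ ≤ 1) ∧ ν Set.univ = ENNReal.ofReal n ∧
      (∀ y, ∫ ω, ⟪u ω, y⟫ ^ 2 ∂ν = ‖y‖ ^ 2) ∧
      ∀ y, ∫ ω, |⟪u ω, y⟫| ^ p ∂ν = n * ‖(J y : Lp ℝ (ENNReal.ofReal p) μ)‖ ^ p := by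
  have hp0 : 0 < p := by linarith
  have : Fact (1 ≤ ENNReal.ofReal p) := ⟨ENNReal.one_le_ofReal.2 (by linarith)⟩
  let b := Module.finBasisOfFinrankEq ℝ X hX
  have hmem : MemLp (fun ω => WithLp.toLp 2 fun i => (b i : Lp ℝ (ENNReal.ofReal p) μ) ω)
      (ENNReal.ofReal p) μ :=
    MemLp.of_eval_piLp fun i => Lp.memLp (b i : Lp ℝ (ENNReal.ofReal p) μ)
  let f : Lp (EuclideanSpace ℝ (Fin n)) (ENNReal.ofReal p) μ := hmem.toLp
  let J₀ : EuclideanSpace ℝ (Fin n) ≃ₗ[ℝ] X :=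
    (EuclideanSpace.basisFun (Fin n) ℝ).toBasis.equiv b (Equiv.refl _)
  let Θ : EuclideanSpace ℝ (Fin n) →ₗ[ℝ] Lp ℝ (ENNReal.ofReal p) μ :=
    { toFun := fun y => (innerSL ℝ y).compLp f
      map_add' := fun y z => by rw [map_add, ContinuousLinearMap.add_compLp]
      map_smul' := fun c y => by
        rw [map_smul, ContinuousLinearMap.smul_compLp, RingHom.id_apply] }
  have hΘ : Θ = X.subtype ∘ₗ (J₀ : EuclideanSpace ℝ (Fin n) →ₗ[ℝ] X) := by
    refine (EuclideanSpace.basisFun (Fin n) ℝ).toBasis.ext fun i => ?_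
    apply Lp.ext
    have h1 : (X.subtype ∘ₗ (J₀ : EuclideanSpace ℝ (Fin n) →ₗ[ℝ] X))
        ((EuclideanSpace.basisFun (Fin n) ℝ).toBasis i) = (b i : Lp ℝ (ENNReal.ofReal p) μ) := by
      simp only [LinearMap.comp_apply, LinearEquiv.coe_coe, J₀, Module.Basis.equiv_apply,
        Equiv.refl_apply, Submodule.subtype_apply]
    rw [h1]
    filter_upwards [(innerSL ℝ ((EuclideanSpace.basisFun (Fin n) ℝ).toBasis i)).coeFn_compLp f,
      hmem.coeFn_toLp] with ω h2 h3
    refine h2.trans ?_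
    rw [h3]
    simp [EuclideanSpace.inner_single_left]
  have hΘJ : ∀ y, (innerSL ℝ y).compLp f = (J₀ y : Lp ℝ (ENNReal.ofReal p) μ) := fun y =>
    DFunLike.congr_fun hΘ y
  have hf : ∀ y, (innerSL ℝ y).compLp f = 0 → y = 0 := fun y hy => by
    rw [hΘJ] at hy
    simpa using hy
  have hfin : Module.finrank ℝ (EuclideanSpace ℝ (Fin n)) = n := by simp
  obtain ⟨A, hA1, hAdet⟩ := exists_det_le_norm_compLp_pow f (by rw [hfin]; exact hn) hf
  obtain ⟨ν, u, hu, hu1, hν, hiso, hpow⟩ := exists_isotropic_of_det_le hp (A.compLp f) hA1 hAdet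
  rw [hfin] at hν
  -- The adjoint appears because ⟨y, A f⟩ = ⟨A* y, f⟩, and pairing with f is the coordinate map J₀
  -- into X.
  refine ⟨ν, u, (J₀ : EuclideanSpace ℝ (Fin n) →ₗ[ℝ] X) ∘ₗ (ContinuousLinearMap.adjoint A :
    EuclideanSpace ℝ (Fin n) →L[ℝ] EuclideanSpace ℝ (Fin n)), hu, hu1, hν, hiso, fun y => ?_⟩
  rw [hpow, hfin]
  congr 1
  rw [LinearMap.comp_apply]
  change _ = ‖(J₀ (ContinuousLinearMap.adjoint A y) : Lp ℝ (ENNReal.ofReal p) μ)‖ ^ p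
  rw [← hΘJ, Lp.norm_rpow_eq_integral_norm_rpow hp0]
  refine integral_congr_ae ?_
  filter_upwards [(innerSL ℝ (ContinuousLinearMap.adjoint A y)).coeFn_compLp f,
    A.coeFn_compLp f] with ω h1 h2
  rw [h1, h2, innerSL_apply_apply, ContinuousLinearMap.adjoint_inner_left, Real.norm_eq_abs]

end Lewis

/-! ### Increments of the functional along a random linear map -/

section RandomSubspace

variable {S : Type*} [MeasurableSpace S] {E : Type*} [NormedAddCommGroup E]
  [InnerProductSpace ℝ E] {ν : Measure S} {u : S → E} {r : ℝ}

lemma powInt_smul (c : ℝ) (x : E) : powInt ν u r (c • x) = |c| ^ r * powInt ν u r x := by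
  rw [powInt, powInt, ← integral_const_mul]
  congr 1
  ext ω
  rw [real_inner_smul_right, abs_mul, Real.mul_rpow (abs_nonneg _) (abs_nonneg _)]

/-- Every unit vector is obtained from another one by a rotation in some plane, or is proportional
to it. -/
lemma exists_rotation_of_norm_eq_one {V : Type*} [NormedAddCommGroup V] [InnerProductSpace ℝ V]
    {a b : V} (ha : ‖a‖ = 1) (hb : ‖b‖ = 1) :
    (b = a ∨ b = -a) ∨ ∃ (τ : ℝ) (w : V), 0 ≤ τ ∧ τ ≤ Real.pi / 2 * ‖b - a‖ ∧ ‖w‖ = 1 ∧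
      ⟪a, w⟫ = 0 ∧ b = Real.cos τ • a + Real.sin τ • w := by
  set c := ⟪a, b⟫ with hc
  have hcabs : |c| ≤ 1 := by
    have := abs_real_inner_le_norm a b; rwa [ha, hb, one_mul] at this
  obtain ⟨hc1, hc2⟩ := abs_le.1 hcabs
  have hw : ‖b - c • a‖ ^ 2 = 1 - c ^ 2 := by
    rw [norm_sub_sq_real, hb, norm_smul, ha, real_inner_smul_right, real_inner_comm, ← hc,
      Real.norm_eq_abs, mul_one, sq_abs]
    ring
  rcases eq_or_ne (b - c • a) 0 with h0 | h0
  · left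
    rw [h0, norm_zero] at hw
    have hb' : b = c • a := sub_eq_zero.1 h0
    have : (c - 1) * (c + 1) = 0 := by linarith
    rcases mul_eq_zero.1 this with h | h
    · left; rw [hb', show c = 1 by linarith, one_smul]
    · right; rw [hb', show c = -1 by linarith, neg_one_smul]
  · right
    have hs : 0 < ‖b - c • a‖ := norm_pos_iff.2 h0
    have hcos : Real.cos (Real.arccos c) = c := Real.cos_arccos hc1 hc2
    have hsin : Real.sin (Real.arccos c) = ‖b - c • a‖ := by
      rw [Real.sin_arccos, ← hw, Real.sqrt_sq hs.le]
    refine ⟨Real.arccos c, ‖b - c • a‖⁻¹ • (b - c • a), Real.arccos_nonneg c, ?_, ?_, ?_, ?_⟩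
    · set τ := Real.arccos c with hτ
      have hτ0 : 0 ≤ τ := Real.arccos_nonneg c
      have hτπ : τ ≤ Real.pi := Real.arccos_le_pi c
      have hsin2 : 0 ≤ Real.sin (τ / 2) :=
        Real.sin_nonneg_of_nonneg_of_le_pi (by linarith) (by linarith)
      have h1 : ‖b - a‖ ^ 2 = (2 * Real.sin (τ / 2)) ^ 2 := by
        have h2 := Real.cos_sq_add_sin_sq (τ / 2)
        have h3 := Real.cos_two_mul (τ / 2)
        rw [mul_div_cancel₀ _ (two_ne_zero), hcos] at h3
        rw [norm_sub_sq_real, ha, hb, real_inner_comm, ← hc]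
        nlinarith
      have h2 : ‖b - a‖ = 2 * Real.sin (τ / 2) :=
        (pow_left_inj₀ (norm_nonneg _) (by positivity) two_ne_zero).1 h1
      -- Jordan's inequality sin x ≥ 2x/π compares the angle with the chord 2 sin(τ/2).
      have h3 := Real.mul_le_sin (x := τ / 2) (by linarith) (by linarith)
      rw [h2]
      have hpi := Real.pi_pos
      calc τ = Real.pi / 2 * (2 * (2 / Real.pi * (τ / 2))) := by field_simp
        _ ≤ _ := by gcongr
    · rw [norm_smul, norm_inv, norm_norm, inv_mul_cancel₀ hs.ne']
    · rw [real_inner_smul_right, inner_sub_right, real_inner_smul_right,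
        real_inner_self_eq_norm_sq, ha, ← hc]
      ring
    · rw [hcos, hsin, smul_smul, mul_inv_cancel₀ hs.ne', one_smul]
      abel

variable [FiniteDimensional ℝ E] [MeasurableSpace E] [BorelSpace E] [IsFiniteMeasure ν]

/-- In the plane of a and b, the Gaussian combinations along a and an orthogonal unit vector are
independent, so this is a rotation increment. If b = ±a there is no plane, but the functional is
even and the increment vanishes. -/
lemma lintegral_powInt_sum_sub_le (hu : Measurable u) (hu1 : ∀ ω, ‖u ω‖ ≤ 1) (hr : 2 < r)
    {q : ℝ} (hq : 1 ≤ q) {ι : Type*} [Fintype ι] {a b : EuclideanSpace ℝ ι}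
    (ha : ‖a‖ = 1) (hb : ‖b‖ = 1) :
    ∫⁻ G : ι → E, ‖powInt ν u r (∑ i, b i • G i) - powInt ν u r (∑ i, a i • G i)‖ₑ ^ q
        ∂(Measure.pi fun _ => stdGaussian E)
      ≤ ENNReal.ofReal (Real.pi * √q * ‖b - a‖) ^ q *
        ∫⁻ z, ‖powGrad ν u r z‖ₑ ^ q ∂(stdGaussian E) := by
  classical
  have hq0 : 0 < q := by linarith
  have hH : Continuous (powInt ν u r) := continuous_powInt hu hu1 (by linarith)
  rcases exists_rotation_of_norm_eq_one ha hb with h | ⟨τ, w, hτ0, hτ, hw, haw, hbw⟩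
  · have : ∀ G : ι → E, powInt ν u r (∑ i, b i • G i) - powInt ν u r (∑ i, a i • G i) = 0 := by
      intro G
      rcases h with h | h
      · rw [h, sub_self]
      · have : ∑ i, b i • G i = (-1 : ℝ) • ∑ i, a i • G i := by
          rw [h]; simp [Finset.sum_neg_distrib]
        rw [this, powInt_smul]; simp
    simp [this, hq0]
  · have h1 : ∀ G : ι → E, ∑ i, b i • G i
        = Real.cos τ • (∑ i, a i • G i) + Real.sin τ • ∑ i, w i • G i := by
      intro G
      rw [hbw, Finset.smul_sum, Finset.smul_sum, ← Finset.sum_add_distrib]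
      refine Finset.sum_congr rfl fun i _ => ?_
      simp [add_smul, mul_smul]
    have h2 := lintegral_powInt_rotation_sub_le (ν := ν) hu hu1 hr hτ0 hq
    rw [← map_pi_stdGaussian_orthonormal ha hw haw,
      lintegral_map (by fun_prop) (by fun_prop)] at h2
    simp_rw [h1]
    have h3 : 2 * √q * τ ≤ Real.pi * √q * ‖b - a‖ :=
      calc 2 * √q * τ ≤ 2 * √q * (Real.pi / 2 * ‖b - a‖) := by gcongr
        _ = _ := by ring
    refine h2.trans ?_
    gcongr

/-- `L_q` norm of the increments in terms of the total mass. -/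
lemma lintegral_powInt_sum_sub_le_of_isotropic (hu : Measurable u) (hu1 : ∀ ω, ‖u ω‖ ≤ 1)
    (hiso : ∀ y, ∫ ω, ⟪u ω, y⟫ ^ 2 ∂ν ≤ ‖y‖ ^ 2) (hr : 2 < r)
    {n : ℝ} (hn : 0 ≤ n) (hν : ν Set.univ ≤ ENNReal.ofReal n)
    {q : ℝ} (hq : 1 ≤ q) {ι : Type*} [Fintype ι] {a b : EuclideanSpace ℝ ι}
    (ha : ‖a‖ = 1) (hb : ‖b‖ = 1) {B : ℝ} (hB : 0 ≤ B)
    (hBle : 2 * Real.pi ^ 2 * q * (r ^ 2 * (8 * (n * (gaussianAbsMoment (2 * r - 2)).toReal +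
      (8 * (2 * r - 2) * (Real.pi * √q)) ^ (2 * r - 2)))) ≤ B ^ 2) :
    ∫⁻ G : ι → E, ‖powInt ν u r (∑ i, b i • G i) - powInt ν u r (∑ i, a i • G i)‖ₑ ^ (2 * q)
        ∂(Measure.pi fun _ => stdGaussian E)
      ≤ ENNReal.ofReal (B * ‖b - a‖) ^ (2 * q) := by
  have hq0 : 0 < q := by linarith
  have hpi := Real.pi_pos
  have hH : Continuous (powInt ν u (2 * r - 2)) := continuous_powInt hu hu1 (by linarith)
  set W := 8 * (n * (gaussianAbsMoment (2 * r - 2)).toReal +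
      (8 * (2 * r - 2) * (Real.pi * √q)) ^ (2 * r - 2)) with hW
  have h22 : 0 ≤ 2 * r - 2 := by linarith
  have hW0 : 0 ≤ W := by positivity
  -- The Bessel inequality trades the 2q-th moment of the gradient for the q-th moment of the
  -- functional with exponent 2r - 2.
  have h1 : ∫⁻ z, ‖powGrad ν u r z‖ₑ ^ (2 * q) ∂(stdGaussian E)
      ≤ ENNReal.ofReal (r ^ 2) ^ q * ENNReal.ofReal W ^ q := by
    refine (lintegral_mono fun z => enorm_powGrad_rpow_le hu hu1 hiso hr hq0.le z).trans ?_
    rw [lintegral_const_mul _ (by fun_prop)]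
    gcongr
    exact lintegral_powInt_rpow_le hu hu1 hiso (by linarith) hq hn hν
  refine (lintegral_powInt_sum_sub_le hu hu1 hr (by linarith) ha hb).trans ?_
  calc _ ≤ ENNReal.ofReal (Real.pi * √(2 * q) * ‖b - a‖) ^ (2 * q) *
        (ENNReal.ofReal (r ^ 2) ^ q * ENNReal.ofReal W ^ q) := by gcongr
    _ = ENNReal.ofReal ((Real.pi * √(2 * q) * ‖b - a‖) ^ (2 : ℝ) * (r ^ 2 * W)) ^ q := by
        rw [ENNReal.rpow_mul, ← ENNReal.mul_rpow_of_nonneg _ _ hq0.le,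
          ← ENNReal.mul_rpow_of_nonneg _ _ hq0.le,
          ENNReal.ofReal_rpow_of_nonneg (by positivity) (by norm_num),
          ← ENNReal.ofReal_mul (by positivity), ← ENNReal.ofReal_mul (by positivity)]
    _ ≤ ENNReal.ofReal ((B * ‖b - a‖) ^ (2 : ℝ)) ^ q := by
        gcongr
        rw [Real.rpow_two, Real.rpow_two, mul_pow, mul_pow, mul_pow, Real.sq_sqrt (by positivity)]
        calc _ = 2 * Real.pi ^ 2 * q * (r ^ 2 * W) * ‖b - a‖ ^ 2 := by ring
          _ ≤ _ := by gcongr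
    _ = _ := by
        rw [ENNReal.rpow_mul]
        congr 1
        exact (ENNReal.ofReal_rpow_of_nonneg (by positivity) (by norm_num)).symm

end RandomSubspace

/-! ### Lower bounds at one point of the sphere -/

section LowerBounds

lemma gaussianAbsMoment_two : gaussianAbsMoment 2 = 1 := by
  have h1 : ∫ t, t ^ 2 ∂(gaussianReal 0 1) = 1 := by
    have h := variance_fun_id_gaussianReal (μ := 0) (v := 1)
    rw [variance_eq_integral (by fun_prop)] at h
    simpa [integral_id_gaussianReal] using h
  have hi : Integrable (fun t : ℝ => t ^ 2) (gaussianReal 0 1) :=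
    (IsGaussian.memLp_id (gaussianReal 0 1) 2 (by simp)).integrable_sq
  rw [gaussianAbsMoment, ← ENNReal.ofReal_one, ← h1,
    ofReal_integral_eq_lintegral_ofReal hi (ae_of_all _ fun _ => by positivity)]
  refine lintegral_congr fun t => ?_
  rw [Real.enorm_eq_ofReal_abs, ENNReal.ofReal_rpow_of_nonneg (abs_nonneg _) (by norm_num),
    Real.rpow_two, sq_abs]

lemma lintegral_ofReal_abs_coord_rpow {n : ℕ} (i : Fin n) {r : ℝ} (hr : 0 ≤ r) :
    ∫⁻ z : EuclideanSpace ℝ (Fin n), ENNReal.ofReal (|z i| ^ r) ∂(stdGaussian _)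
      = gaussianAbsMoment r := by
  have h := lintegral_inner_rpow_stdGaussian (EuclideanSpace.single i (1 : ℝ)) hr
  rw [← ofReal_norm, PiLp.norm_single, norm_one, ENNReal.ofReal_one, ENNReal.one_rpow,
    one_mul] at h
  rw [← h]
  refine lintegral_congr fun z => ?_
  rw [EuclideanSpace.inner_single_left, map_one, one_mul, Real.enorm_eq_ofReal_abs,
    ENNReal.ofReal_rpow_of_nonneg (abs_nonneg _) hr]

lemma lintegral_norm_sq_stdGaussian (n : ℕ) :
    ∫⁻ z : EuclideanSpace ℝ (Fin n), ENNReal.ofReal (‖z‖ ^ 2) ∂(stdGaussian _)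
      = ENNReal.ofReal n := by
  have h1 : ∀ z : EuclideanSpace ℝ (Fin n), ENNReal.ofReal (‖z‖ ^ 2)
      = ∑ i, ENNReal.ofReal (|z i| ^ (2 : ℝ)) := by
    intro z
    rw [EuclideanSpace.real_norm_sq_eq, ENNReal.ofReal_sum_of_nonneg fun _ _ => by positivity]
    simp
  simp_rw [h1]
  rw [lintegral_finsetSum _ fun i _ => by fun_prop]
  simp_rw [lintegral_ofReal_abs_coord_rpow _ (zero_le_two (α := ℝ)), gaussianAbsMoment_two]
  simp

lemma lintegral_norm_pow_four_stdGaussian_le (n : ℕ) :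
    ∫⁻ z : EuclideanSpace ℝ (Fin n), ENNReal.ofReal ((‖z‖ ^ 2) ^ 2) ∂(stdGaussian _)
      ≤ ENNReal.ofReal (256 * n ^ 2) := by
  have h1 : ∀ z : EuclideanSpace ℝ (Fin n), ENNReal.ofReal ((‖z‖ ^ 2) ^ 2)
      ≤ n * ∑ i, ENNReal.ofReal (|z i| ^ (4 : ℝ)) := by
    intro z
    rw [← ENNReal.ofReal_sum_of_nonneg fun _ _ => by positivity, ← ENNReal.ofReal_natCast,
      ← ENNReal.ofReal_mul (by positivity)]
    apply ENNReal.ofReal_le_ofReal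
    rw [EuclideanSpace.real_norm_sq_eq]
    refine (sq_sum_le_card_mul_sum_sq (s := Finset.univ) (f := fun i => z i ^ 2)).trans
      (le_of_eq ?_)
    rw [Finset.card_univ, Fintype.card_fin]
    congr 1
    refine Finset.sum_congr rfl fun i _ => ?_
    rw [show (4 : ℝ) = ((4 : ℕ) : ℝ) by norm_num, Real.rpow_natCast, ← pow_mul]
    exact (Even.pow_abs (by decide) _).symm
  refine (lintegral_mono h1).trans ?_
  rw [lintegral_const_mul _ (by fun_prop), lintegral_finsetSum _ fun i _ => by fun_prop]
  simp_rw [lintegral_ofReal_abs_coord_rpow _ (by norm_num : (0 : ℝ) ≤ 4)]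
  rw [Finset.sum_const, Finset.card_univ, Fintype.card_fin, nsmul_eq_mul]
  have h4 : gaussianAbsMoment 4 ≤ ENNReal.ofReal 256 := by
    refine (gaussianAbsMoment_le (by norm_num : (1 : ℝ) ≤ 4)).trans (le_of_eq ?_)
    rw [show √(4 : ℝ) = 2 by rw [show (4 : ℝ) = 2 ^ 2 by norm_num]; exact Real.sqrt_sq (by norm_num),
      ENNReal.ofReal_rpow_of_nonneg (by norm_num) (by norm_num)]
    norm_num
  calc (n : ℝ≥0∞) * (n * gaussianAbsMoment 4) ≤ n * (n * ENNReal.ofReal 256) := by gcongr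
    _ = _ := by
      rw [← ENNReal.ofReal_natCast, ← ENNReal.ofReal_mul (by positivity),
        ← ENNReal.ofReal_mul (by positivity)]
      congr 1; ring

/-- A Paley–Zygmund argument: outside a small set, a Gaussian vector attains a large norm. -/
lemma exists_notMem_norm_sq_ge {Ω : Type*} [MeasurableSpace Ω] {P : Measure Ω}
    [IsProbabilityMeasure P] {n : ℕ} (hn : n ≠ 0) {Z : Ω → EuclideanSpace ℝ (Fin n)}
    (hZ : Measurable Z) (hlaw : P.map Z = stdGaussian _) {T : Set Ω}
    (hT : P T ≤ ENNReal.ofReal (1 / 2000)) : ∃ ω, ω ∉ T ∧ (n : ℝ) / 2 ≤ ‖Z ω‖ ^ 2 := by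
  by_contra! hcon
  have hn0 : (0 : ℝ) < n := by positivity
  have h1 : ∫⁻ ω, ENNReal.ofReal (‖Z ω‖ ^ 2) ∂P = ENNReal.ofReal n := by
    rw [← lintegral_norm_sq_stdGaussian, ← hlaw, lintegral_map (by fun_prop) hZ]
  have h2 : ∫⁻ ω, ENNReal.ofReal ((‖Z ω‖ ^ 2) ^ 2) ∂P ≤ ENNReal.ofReal (256 * n ^ 2) := by
    refine le_trans (le_of_eq ?_) (lintegral_norm_pow_four_stdGaussian_le n)
    rw [← hlaw, lintegral_map (by fun_prop) hZ]
  -- T is an uncountable union of events, in the application, so its measurability is not assumed.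
  set T' := toMeasurable P T
  have hT'm : MeasurableSet T' := measurableSet_toMeasurable P T
  have hT' : P T' ≤ ENNReal.ofReal (1 / 2000) := by rwa [measure_toMeasurable]
  -- On T use v ≤ v²/(1024n) + 256n with v = ‖Z‖². Integrating yields n ≤ n/2 + n/4 + 256n/2000,
  -- which is absurd.
  have hpt : ∀ ω, ENNReal.ofReal (‖Z ω‖ ^ 2) ≤ ENNReal.ofReal (n / 2) +
      (ENNReal.ofReal (1 / (1024 * n)) * ENNReal.ofReal ((‖Z ω‖ ^ 2) ^ 2) +
        T'.indicator (fun _ => ENNReal.ofReal (256 * n)) ω) := by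
    intro ω
    by_cases hω : ω ∈ T
    · rw [Set.indicator_of_mem (subset_toMeasurable P T hω), ← ENNReal.ofReal_mul (by positivity),
        ← ENNReal.ofReal_add (by positivity) (by positivity)]
      refine le_trans (ENNReal.ofReal_le_ofReal ?_) le_add_self
      have h3 : 1 / (1024 * n) * (‖Z ω‖ ^ 2) ^ 2 + 256 * n - ‖Z ω‖ ^ 2
          = (‖Z ω‖ ^ 2 - 512 * n) ^ 2 / (1024 * n) := by
        field_simp; ring
      have h4 : 0 ≤ (‖Z ω‖ ^ 2 - 512 * n) ^ 2 / (1024 * n) := by positivity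
      linarith
    · exact le_add_right (ENNReal.ofReal_le_ofReal (hcon ω hω).le)
  have h3 : ENNReal.ofReal n ≤ ENNReal.ofReal (n / 2) + (ENNReal.ofReal (1 / (1024 * n)) *
      ENNReal.ofReal (256 * n ^ 2) + ENNReal.ofReal (256 * n) * ENNReal.ofReal (1 / 2000)) := by
    rw [← h1]
    refine (lintegral_mono hpt).trans ?_
    rw [lintegral_add_left measurable_const, lintegral_const, measure_univ, mul_one,
      lintegral_add_left (by fun_prop), lintegral_const_mul _ (by fun_prop),
      lintegral_indicator_const hT'm]
    gcongr
  rw [← ENNReal.ofReal_mul (by positivity), ← ENNReal.ofReal_mul (by positivity),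
    ← ENNReal.ofReal_add (by positivity) (by positivity),
    ← ENNReal.ofReal_add (by positivity) (by positivity),
    ENNReal.ofReal_le_ofReal_iff (by positivity)] at h3
  have h4 : 1 / (1024 * (n : ℝ)) * (256 * n ^ 2) = n / 4 := by field_simp; norm_num
  rw [h4] at h3
  linarith

/-- Hölder's inequality between the second and the `r`-th moments of an isotropic measure. -/
lemma le_powInt_of_isotropic {S E : Type*} [MeasurableSpace S] [NormedAddCommGroup E]
    [InnerProductSpace ℝ E] [FiniteDimensional ℝ E] [MeasurableSpace E] [BorelSpace E]
    {ν : Measure S} {u : S → E} {r n : ℝ} (hu : Measurable u) (hu1 : ∀ ω, ‖u ω‖ ≤ 1)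
    (hiso : ∀ y, ∫ ω, ⟪u ω, y⟫ ^ 2 ∂ν = ‖y‖ ^ 2) (hr : 2 < r) (hn : 0 < n)
    (hν : ν Set.univ = ENNReal.ofReal n) {x : E} {s : ℝ} (hs : 0 ≤ s)
    (hx : s ^ 2 * n ≤ ‖x‖ ^ 2) :
    s ^ r * n ≤ powInt ν u r x := by
  have : IsFiniteMeasure ν := ⟨by rw [hν]; exact ENNReal.ofReal_lt_top⟩
  rcases eq_or_lt_of_le hs with rfl | hs
  · rw [Real.zero_rpow (by linarith), zero_mul]; exact powInt_nonneg x
  have h2 : Integrable (fun ω => ⟪u ω, x⟫ ^ 2) ν := by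
    have := integrable_powInt (ν := ν) hu hu1 (r := 2) (by norm_num) x
    simpa using this
  -- The convex function v ↦ v^(r/2) lies above its tangent at v = s² (Bernoulli); isotropy
  -- evaluates the integral of the tangent.
  have hpt : ∀ ω, s ^ r * (1 - r / 2) + s ^ r * (r / 2) / s ^ 2 * ⟪u ω, x⟫ ^ 2
      ≤ |⟪u ω, x⟫| ^ r := by
    intro ω
    set t := ⟪u ω, x⟫
    have h1 := one_add_mul_self_le_rpow_one_add (s := (|t| / s) ^ 2 - 1)
      (by linarith [sq_nonneg (|t| / s)]) (p := r / 2) (by linarith)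
    rw [add_sub_cancel, ← Real.rpow_natCast, ← Real.rpow_mul (by positivity),
      show ((2 : ℕ) : ℝ) * (r / 2) = r by push_cast; ring, Real.rpow_natCast,
      Real.div_rpow (abs_nonneg _) hs.le, le_div_iff₀ (by positivity), div_pow, sq_abs] at h1
    refine le_trans (le_of_eq ?_) h1
    ring
  have hint := integral_mono ((integrable_const _).add (h2.const_mul _))
    (integrable_powInt (ν := ν) hu hu1 (r := r) (by linarith) x) hpt
  rw [integral_add' (integrable_const _) (h2.const_mul _), integral_const, integral_const_mul,
    hiso, Measure.real, hν, ENNReal.toReal_ofReal hn.le, smul_eq_mul] at hint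
  refine le_trans ?_ hint
  have h3 : s ^ r * (r / 2) / s ^ 2 * (s ^ 2 * n) ≤ s ^ r * (r / 2) / s ^ 2 * ‖x‖ ^ 2 := by
    gcongr
  have h4 : s ^ r * (r / 2) / s ^ 2 * (s ^ 2 * n) = s ^ r * (r / 2) * n := by field_simp
  linarith

end LowerBounds

/-! ### Choice of constants and the embedding -/

/-- The left side is a constant times k^p; this is where the exponent 2/p in the dimension comes
from. -/
lemma rpow_mul_sqrt_le {p c k t : ℝ} (hp : 2 < p) (hc : 0 ≤ c) (hk : 0 ≤ k) (ht : 0 ≤ t)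
    (hkt : k ≤ t ^ (2 / p)) :
    k * (c * √(4 * k)) ^ (2 * p - 2) ≤ (2 * c) ^ (2 * p - 2) * t ^ 2 := by
  have hp0 : 0 < p := by linarith
  have h1 : c * √(4 * k) = 2 * c * k ^ (1 / 2 : ℝ) := by
    rw [Real.sqrt_mul (by norm_num), ← Real.sqrt_eq_rpow,
      show (4 : ℝ) = 2 ^ 2 by norm_num, Real.sqrt_sq (by norm_num)]
    ring
  have h2 : k * k ^ (p - 1) = k ^ p := by
    nth_rw 1 [← Real.rpow_one k]
    rw [← Real.rpow_add_of_nonneg hk zero_le_one (by linarith)]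
    congr 1; ring
  have h3 : k ^ p ≤ t ^ 2 := by
    calc k ^ p ≤ (t ^ (2 / p)) ^ p := by gcongr
      _ = t ^ 2 := by rw [← Real.rpow_mul ht, div_mul_cancel₀ _ hp0.ne', Real.rpow_two]
  rw [h1, Real.mul_rpow (by positivity) (by positivity), ← Real.rpow_mul hk,
    show 1 / 2 * (2 * p - 2) = p - 1 by ring, mul_left_comm, h2]
  gcongr

/-- A random subspace of dimension `k` is almost spherical for an isotropic `powInt`. -/
theorem exists_almost_spherical {p : ℝ} (hp : 2 < p) :
    ∃ c : ℝ, 0 < c ∧ c ≤ 1 ∧ ∀ (S : Type*) [MeasurableSpace S] (n : ℕ), n ≠ 0 →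
      ∀ (ν : Measure S) (u : S → EuclideanSpace ℝ (Fin n)), Measurable u → (∀ ω, ‖u ω‖ ≤ 1) →
      ν Set.univ = ENNReal.ofReal n → (∀ y, ∫ ω, ⟪u ω, y⟫ ^ 2 ∂ν = ‖y‖ ^ 2) →
      ∀ ε : ℝ, 0 < ε → ε < 1 → ∀ k : ℕ, k ≠ 0 → (k : ℝ) ≤ c * (ε ^ 2 * n) →
        (k : ℝ) ≤ (c * (ε * n)) ^ (2 / p) →
        ∃ (L : EuclideanSpace ℝ (Fin k) →ₗ[ℝ] EuclideanSpace ℝ (Fin n)) (m : ℝ), 0 < m ∧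
          ∀ x, ‖x‖ = 1 → m ≤ powInt ν u p (L x) ∧ powInt ν u p (L x) ≤ (1 + ε) * m := by
  have hp0 : 0 < p := by linarith
  have hpi := Real.pi_pos
  set s : ℝ := √(1 / 2) with hs
  have hs0 : 0 < s := Real.sqrt_pos.2 (by norm_num)
  -- The lower bound s^p n equals 128δn, so the oscillation 32δεn from chaining with B = δεn is at
  -- most ε/4 of the value at a.
  set δ : ℝ := s ^ p / 128 with hδ
  have hδ0 : 0 < δ := by positivity
  set γ : ℝ := (gaussianAbsMoment (2 * p - 2)).toReal with hγ
  have hγ0 : 0 ≤ γ := ENNReal.toReal_nonneg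
  set C : ℝ := (2 * (8 * (2 * p - 2) * Real.pi)) ^ (2 * p - 2) with hC
  have h2p : 0 < 2 * p - 2 := by linarith
  have hC0 : 0 < C := by positivity
  set K : ℝ := 64 * Real.pi ^ 2 * p ^ 2 * (γ + C) with hK
  have hK0 : 0 < K := by positivity
  refine ⟨min 1 (δ ^ 2 / K), by positivity, min_le_left _ _, ?_⟩
  intro S _ n hn ν u hu hu1 hν hiso ε hε hε1 k hk hk1 hk2
  set c := min 1 (δ ^ 2 / K) with hc
  have hc0 : 0 < c := by positivity
  have hc1 : c ≤ 1 := min_le_left _ _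
  have hcK : K * c ≤ δ ^ 2 := by
    have := min_le_right 1 (δ ^ 2 / K)
    rw [← hc, le_div_iff₀ hK0] at this
    linarith
  have hn0 : (0 : ℝ) < n := by positivity
  have hk0 : (1 : ℝ) ≤ k := by exact_mod_cast Nat.one_le_iff_ne_zero.2 hk
  have : IsFiniteMeasure ν := ⟨by rw [hν]; exact ENNReal.ofReal_lt_top⟩
  have hcε : 0 < c * (ε * n) := by positivity
  -- With q = 4k, hence 2q = 8k as chaining requires, the term in kn is controlled by k ≤ cε²n and
  -- the term in k^p by k ≤ (cεn)^(2/p).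
  have hbound : 2 * Real.pi ^ 2 * (4 * k) * (p ^ 2 * (8 * (n * γ +
      (8 * (2 * p - 2) * (Real.pi * √(4 * k))) ^ (2 * p - 2)))) ≤ (δ * ε * n) ^ 2 := by
    have h1 := rpow_mul_sqrt_le hp (c := 8 * (2 * p - 2) * Real.pi) (by positivity)
      (by linarith) hcε.le hk2
    rw [← hC] at h1
    have h2 : (k : ℝ) * n ≤ c * (ε * n) ^ 2 := by
      calc (k : ℝ) * n ≤ c * (ε ^ 2 * n) * n := by gcongr
        _ = _ := by ring
    have h3 : (c * (ε * n)) ^ 2 ≤ c * (ε * n) ^ 2 := by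
      rw [mul_pow]
      gcongr
      exact pow_le_of_le_one hc0.le hc1 two_ne_zero
    calc _ = 64 * Real.pi ^ 2 * p ^ 2 * (γ * (k * n) +
          k * (8 * (2 * p - 2) * Real.pi * √(4 * k)) ^ (2 * p - 2)) := by
          rw [← mul_assoc (8 * (2 * p - 2)) Real.pi]; ring
      _ ≤ 64 * Real.pi ^ 2 * p ^ 2 * (γ * (c * (ε * n) ^ 2) + C * (c * (ε * n) ^ 2)) := by
          have h4 := h1.trans (mul_le_mul_of_nonneg_left h3 hC0.le)
          gcongr
      _ = K * c * (ε * n) ^ 2 := by rw [hK]; ring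
      _ ≤ δ ^ 2 * (ε * n) ^ 2 := by gcongr
      _ = _ := by ring
  let P : Measure (Fin k → EuclideanSpace ℝ (Fin n)) := Measure.pi fun _ => stdGaussian _
  let Lin : (Fin k → EuclideanSpace ℝ (Fin n)) →
      EuclideanSpace ℝ (Fin k) →ₗ[ℝ] EuclideanSpace ℝ (Fin n) := fun G =>
    { toFun := fun x => ∑ i, x i • G i
      map_add' := fun x y => by simp [add_smul, Finset.sum_add_distrib]
      map_smul' := fun a x => by simp [mul_smul, Finset.smul_sum] }
  have hLin : ∀ G x, Lin G x = ∑ i, x i • G i := fun _ _ => rfl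
  have hH : Continuous (powInt ν u p) := continuous_powInt hu hu1 hp0
  let a : EuclideanSpace ℝ (Fin k) := EuclideanSpace.single ⟨0, Nat.pos_of_ne_zero hk⟩ 1
  have ha : ‖a‖ = 1 := by simp [a]
  have hbad := measure_exists_increment_gt_le (V := EuclideanSpace ℝ (Fin k)) (P := P)
    (f := fun G x => powInt ν u p (Lin G x)) (k := k) (B := δ * ε * n) (by simp) hk
    (fun x => by simp only [hLin]; fun_prop)
    (fun G => hH.comp (Lin G).continuous_of_finiteDimensional) (by positivity)
    (fun x y hx hy => by
      have h := lintegral_powInt_sum_sub_le_of_isotropic hu hu1 (fun y => (hiso y).le) hp hn0.le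
        hν.le (q := 4 * k) (by linarith) hy hx (B := δ * ε * n) (by positivity) hbound
      have e : (2 * (4 * (k : ℝ))) = ((8 * k : ℕ) : ℝ) := by push_cast; ring
      rw [e] at h
      simp_rw [ENNReal.rpow_natCast] at h
      exact h) ha
  obtain ⟨G, hG, hGa⟩ := exists_notMem_norm_sq_ge (P := P) hn (Z := fun G => Lin G a)
    (by simp only [hLin]; fun_prop) (map_pi_stdGaussian_unit ha) hbad
  simp only [Set.mem_ofPred_eq, not_exists, not_and, not_lt] at hG
  have hlow : 128 * δ * n ≤ powInt ν u p (Lin G a) := by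
    have := le_powInt_of_isotropic hu hu1 hiso hp hn0 hν (x := Lin G a) hs0.le (by
      rw [hs, Real.sq_sqrt (by norm_num)]; linarith)
    calc _ = s ^ p * n := by rw [hδ]; ring
      _ ≤ _ := this
  set F := powInt ν u p (Lin G a) with hF
  have hεF : 32 * (δ * ε * n) ≤ ε / 4 * F := by
    calc _ = ε / 4 * (128 * δ * n) := by ring
      _ ≤ _ := by gcongr
  have hF0 : 0 < F := lt_of_lt_of_le (by positivity) hlow
  refine ⟨Lin G, (1 - ε / 4) * F, mul_pos (by linarith) hF0, fun x hx => ?_⟩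
  obtain ⟨h1, h2⟩ := abs_le.1 ((hG x hx).trans hεF)
  refine ⟨by linarith, ?_⟩
  have h3 : (1 + ε / 4) * F ≤ (1 + ε) * (1 - ε / 4) * F := by
    gcongr
    nlinarith
  linarith

lemma euclideanEmbeds_zero {Ω : Type*} [MeasurableSpace Ω] {μ : Measure Ω} {q : ℝ≥0∞} (ε : ℝ)
    (X : Submodule ℝ (Lp ℝ q μ)) : EuclideanEmbeds 0 ε X := by
  refine ⟨0, fun x => ?_⟩
  rw [Subsingleton.elim x 0]
  simp

lemma euclideanEmbeds_one {Ω : Type*} [MeasurableSpace Ω] {μ : Measure Ω} {q : ℝ≥0∞}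
    [Fact (1 ≤ q)] {ε : ℝ} (hε : 0 < ε) (X : Submodule ℝ (Lp ℝ q μ)) (hX : Nontrivial X) :
    EuclideanEmbeds 1 ε X := by
  obtain ⟨v, hv⟩ := exists_norm_eq X zero_le_one
  refine ⟨(LinearMap.toSpanSingleton ℝ X v) ∘ₗ
    (EuclideanSpace.proj (0 : Fin 1) : EuclideanSpace ℝ (Fin 1) →L[ℝ] ℝ).toLinearMap,
    fun x => ?_⟩
  have h : ‖(((LinearMap.toSpanSingleton ℝ X v) ∘ₗ (EuclideanSpace.proj (0 : Fin 1) :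
      EuclideanSpace ℝ (Fin 1) →L[ℝ] ℝ).toLinearMap) x : Lp ℝ q μ)‖ = ‖x‖ := by
    have hv' : ‖(v : Lp ℝ q μ)‖ = 1 := hv
    rw [EuclideanSpace.norm_eq x]
    simp [norm_smul, hv', Real.sqrt_sq_eq_abs]
  rw [h]
  exact ⟨le_rfl, by nlinarith [norm_nonneg x]⟩

lemma embedPsi_le {p : ℝ} (hp : 2 < p) (n : ℕ) (t : ℝ) :
    embedPsi n p t ≤ min (t ^ 2 * n) ((t * n) ^ (2 / p)) := by
  refine min_le_min_right _ (div_le_self (by positivity) ?_)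
  have h1 : (1 : ℝ) ≤ 4 ^ p := Real.one_le_rpow (by norm_num) (by linarith)
  nlinarith

/-- A linear map into `X` on which the `p`-th power of the norm is almost spherical gives an
embedding. -/
lemma euclideanEmbeds_of_rpow_bounds {Ω : Type*} [MeasurableSpace Ω] {μ : Measure Ω} {p : ℝ}
    (hp : 2 < p) {X : Submodule ℝ (Lp ℝ (ENNReal.ofReal p) μ)} {k : ℕ} {ε m : ℝ} (hε : 0 < ε)
    (hm : 0 < m) (T : EuclideanSpace ℝ (Fin k) →ₗ[ℝ] X)
    (hT : ∀ x, ‖x‖ = 1 → m ≤ ‖(T x : Lp ℝ (ENNReal.ofReal p) μ)‖ ^ p ∧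
      ‖(T x : Lp ℝ (ENNReal.ofReal p) μ)‖ ^ p ≤ (1 + ε) * m) : EuclideanEmbeds k ε X := by
  have hp0 : 0 < p := by linarith
  have : Fact (1 ≤ ENNReal.ofReal p) := ⟨ENNReal.one_le_ofReal.2 (by linarith)⟩
  set l : ℝ := m ^ (1 / p) with hl
  have hl0 : 0 < l := by positivity
  have hlp : l ^ p = m := by
    rw [hl, ← Real.rpow_mul hm.le, one_div_mul_cancel hp0.ne', Real.rpow_one]
  refine ⟨l⁻¹ • T, fun x => ?_⟩
  have hnorm : ‖((l⁻¹ • T) x : Lp ℝ (ENNReal.ofReal p) μ)‖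
      = l⁻¹ * ‖(T x : Lp ℝ (ENNReal.ofReal p) μ)‖ := by
    rw [LinearMap.smul_apply, Submodule.coe_smul, norm_smul, Real.norm_of_nonneg (by positivity)]
  rw [hnorm]
  rcases eq_or_ne x 0 with rfl | hx
  · simp
  have hx0 : 0 < ‖x‖ := norm_pos_iff.2 hx
  have hunit : ‖‖x‖⁻¹ • x‖ = 1 := by rw [norm_smul, norm_inv, norm_norm, inv_mul_cancel₀ hx0.ne']
  have hval : ‖(T (‖x‖⁻¹ • x) : Lp ℝ (ENNReal.ofReal p) μ)‖
      = ‖x‖⁻¹ * ‖(T x : Lp ℝ (ENNReal.ofReal p) μ)‖ := by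
    rw [map_smul, Submodule.coe_smul, norm_smul, norm_inv, norm_norm]
  obtain ⟨h1, h2⟩ := hT _ hunit
  set N := ‖(T (‖x‖⁻¹ • x) : Lp ℝ (ENNReal.ofReal p) μ)‖ with hN
  have hN0 : 0 ≤ N := norm_nonneg (T (‖x‖⁻¹ • x))
  have hTx : ‖(T x : Lp ℝ (ENNReal.ofReal p) μ)‖ = ‖x‖ * N := by
    rw [hval]; field_simp
  have h3 : l ≤ N := by
    rw [← Real.rpow_le_rpow_iff hl0.le hN0 hp0, hlp]; exact h1
  have h4 : N ≤ (1 + ε) * l := by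
    rw [← Real.rpow_le_rpow_iff hN0 (by positivity) hp0, Real.mul_rpow (by positivity) hl0.le, hlp]
    refine h2.trans ?_
    gcongr
    -- No constant is lost in taking p-th roots, as 1 + ε ≤ (1 + ε)^p.
    exact Real.self_le_rpow_of_one_le (by linarith) (by linarith)
  rw [hTx, inv_mul_eq_div]
  constructor
  · rw [le_div_iff₀ hl0]; gcongr
  · rw [div_le_iff₀ hl0]
    calc ‖x‖ * N ≤ ‖x‖ * ((1 + ε) * l) := by gcongr
      _ = _ := by ring

theorem theorem1 (p : ℝ) (hp : 2 < p) :
    ∃ c : ℝ, 0 < c ∧ ∃ c' : ℝ, 0 < c' ∧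
      ∀ (Ω : Type*) [MeasurableSpace Ω] (μ : MeasureTheory.Measure Ω) (n : ℕ)
        (X : Submodule ℝ (MeasureTheory.Lp ℝ (ENNReal.ofReal p) μ)),
        FiniteDimensional ℝ X → Module.finrank ℝ X = n →
        ∀ ε : ℝ, 0 < ε → ε < 1 →
          ∃ k : ℕ, c * embedPsi n p ε ≤ (k : ℝ) ∧
            c' * min (ε ^ 2 * (n : ℝ)) ((ε * (n : ℝ)) ^ (2 / p)) ≤ (k : ℝ) ∧
            EuclideanEmbeds k ε X := by
  have hp0 : 0 < p := by linarith
  have : Fact (1 ≤ ENNReal.ofReal p) := ⟨ENNReal.one_le_ofReal.2 (by linarith)⟩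
  obtain ⟨c₀, hc0, hc1, hmain⟩ := exists_almost_spherical hp
  refine ⟨c₀ / 2, by positivity, c₀ / 2, by positivity, fun Ω _ μ n X hfin hX ε hε hε1 => ?_⟩
  set M := min (ε ^ 2 * (n : ℝ)) ((ε * (n : ℝ)) ^ (2 / p)) with hM
  suffices h : ∃ k : ℕ, c₀ / 2 * M ≤ k ∧ EuclideanEmbeds k ε X by
    obtain ⟨k, hk, hemb⟩ := h
    exact ⟨k, (mul_le_mul_of_nonneg_left (embedPsi_le hp n ε) (by positivity)).trans hk, hk, hemb⟩
  rcases eq_or_ne n 0 with rfl | hn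
  · exact ⟨0, by simp [hM, hp0.ne'], euclideanEmbeds_zero ε X⟩
  -- If the required dimension is at most 1, any line in X works. Otherwise rounding up at most
  -- doubles, so ⌈c₀M/2⌉ ≤ c₀M; hence the factor 1/2.
  rcases le_or_gt (c₀ / 2 * M) 1 with hle | hgt
  · have hnt : Nontrivial X := Module.nontrivial_of_finrank_pos (R := ℝ) (by omega)
    exact ⟨1, by simpa using hle, euclideanEmbeds_one hε X hnt⟩
  obtain ⟨ν, u, J, hu, hu1, hν, hiso, hpow⟩ := exists_isotropic_representation hp hn X hX
  have hn0 : (0 : ℝ) < n := by positivity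
  set k := ⌈c₀ / 2 * M⌉₊ with hk
  have hk0 : k ≠ 0 := (Nat.ceil_pos.2 (by linarith)).ne'
  have hkM : (k : ℝ) ≤ c₀ * M := by
    have := Nat.ceil_lt_add_one (show 0 ≤ c₀ / 2 * M by linarith)
    linarith
  have hk2 : (k : ℝ) ≤ (c₀ * (ε * n)) ^ (2 / p) := by
    rw [Real.mul_rpow hc0.le (by positivity)]
    refine hkM.trans (mul_le_mul ?_ (min_le_right _ _) (by positivity) (by positivity))
    exact Real.self_le_rpow_of_le_one hc0.le hc1 (by rw [div_le_one hp0]; linarith)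
  obtain ⟨L, m, hm, hL⟩ := hmain Ω n hn ν u hu hu1 hν hiso ε hε hε1 k hk0
    (hkM.trans (by gcongr; exact min_le_left _ _)) hk2
  refine ⟨k, Nat.le_ceil _, euclideanEmbeds_of_rpow_bounds hp hε (div_pos hm hn0) (J ∘ₗ L)
    fun x hx => ?_⟩
  obtain ⟨h1, h2⟩ := hL x hx
  rw [powInt, hpow] at h1 h2
  rw [LinearMap.comp_apply, div_le_iff₀ hn0, ← mul_div_assoc, le_div_iff₀ hn0]
  exact ⟨by linarith, by linarith⟩
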